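/- Let $n\ge 1$, $F=\mathbb{R}((t))$, $R=\mathbb{R}[[t]]$ and $R_-=\mathbb{R}[t^{-1}]t^{-1}$, so that $F^n=R^n\oplus R_-^n$. Functions on $R_-^n$ are identified with $R^n$-periodic functions on $F^n$ through the projection $F^n\to R_-^n$. Let $\mathcal{S}(R_-^n)$ be the space of complex-valued functions on $R_-^n$ whose restriction to every finite-dimensional real subspace is a Schwartz function. Let $M_n'(R)$ be the semigroup of $n\times n$ matrices over $R$ with non-zero determinant. For $g\in M_n'(R)$ put $V_g=g^{-1}R^n/R^n$, a finite-dimensional real vector space, and for a Haar measure $\mu$ on $V_g$ put $$\pi(g,\mu)f(x)=\int_{V_g}f(g^{-1}x+y)\,\mu(dy).$$ The pairs $(g,\mu)$ form a semigroup under $(g_1,\mu_1)(g_2,\mu_2)=(g_1g_2,\mu_1*\mu_2)$, where $\mu_1*\mu_2$ is the Haar measure on $V_{g_1g_2}$ with $$\int_{V_{g_1g_2}} f\,d(\mu_1*\mu_2)=\int_{V_{g_1}}\int_{V_{g_2}}f(g_2^{-1}y+z)\,\mu_2(dz)\,\mu_1(dy)\qquad (f\in L^1(V_{g_1g_2})).$$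 For $l\ge 0$ let $\mu_{st}$ be the Haar measure on $V_{t^lI_n}$ for which the parallelotope spanned by the basis $t^{-i}e_j$ ($1\le i\le l$, $1\le j\le n$) has volume $1$ (the counting measure if $l=0$). For $\lambda\in\mathbb{C}$ let $$\mathcal{S}(R_-^n)_\lambda=\{f\in\mathcal{S}(R_-^n)\mid \pi(tI_n,\mu_{st})f=\lambda f\}.$$ Let $GL_n(F)_0$ be the group of $g\in GL_n(F)$ such that the coefficient of the lowest power of $t$ in $\det g$ is $\pm1$, and let $\widehat{M}_n(R)_0'$ be the semigroup of pairs $(g,\mu)$ as above with $g\in GL_n(F)_0\cap M_n'(R)$. Let $\widehat{GL}_n(F)_0$ be the quotient of the product semigroup $\{t^k\mid k\in\mathbb{Z}\}\times\widehat{M}_n(R)_0'$ by the equivalence relation, compatible with the product, generated by $$(t^{k+l},\alpha)\sim(t^k,(t^lI_n,\mu_{st})\,\alpha)\qquad(k\in\mathbb{Z},\ l\ge 0).$$ It is a group, and $(t^k,(g,\mu))\mapsto t^kg$ makes it a central extension of $GL_n(F)_0$ by $\mathbb{R}_{>0}$; let $\widehat{SL}_n(F)$ be the inverse image of $SL_n(F)$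 in it. **Theorem.** Let $\lambda\in\mathbb{C}$, $\lambda\ne 0$. Then $\mathcal{S}(R_-^n)_\lambda$ is a representation of the group $\widehat{GL}_n(F)_0$, in which the element represented by $(t^l,(g,\mu))$ acts as $$\pi(t^l,(g,\mu))f(x)=\lambda^l\,\pi(g,\mu)f(x)=\lambda^l\int_{V_g}f(g^{-1}x+y)\,\mu(dy)$$ (in particular this is well defined, the integrals converge, and the operators preserve $\mathcal{S}(R_-^n)_\lambda$). By restriction, $\mathcal{S}(R_-^n)_\lambda$ is a representation of $\widehat{SL}_n(F)$. -/

import Mathlib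

open MeasureTheory

namespace LoopRep

noncomputable section

/-- The field `F = ℝ((t))`. -/
abbrev F : Type := LaurentSeries ℝ

/-- The subring `R = ℝ[[t]]` of `F`. -/
def R : Subring F := (HahnSeries.ofPowerSeries ℤ ℝ).range

theorem mem_R_iff (a : F) : a ∈ R ↔ ∀ k : ℤ, k < 0 → a.coeff k = 0 := by
  constructor
  · rintro ⟨p, rfl⟩ k hk
    rw [HahnSeries.ofPowerSeries_apply]
    apply HahnSeries.embDomain_of_notMem_range
    rintro ⟨m, hm⟩
    have : (m : ℤ) = k := by simpa using hm
    omega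
  · intro h
    refine ⟨PowerSeries.mk fun m => a.coeff m, ?_⟩
    ext k
    rcases lt_or_ge k 0 with hk | hk
    · rw [h k hk, HahnSeries.ofPowerSeries_apply]
      apply HahnSeries.embDomain_of_notMem_range
      rintro ⟨m, hm⟩
      have : (m : ℤ) = k := by simpa using hm
      omega
    · lift k to ℕ using hk
      rw [LaurentSeries.coeff_coe_powerSeries, PowerSeries.coeff_mk]

/-- The lattice `R^n` in `F^n`, as a real vector space. -/
def latR (n : ℕ) : Submodule ℝ (Fin n → F) where
  carrier := {x | ∀ i, x i ∈ R}
  add_mem' hx hy i := R.add_mem (hx i) (hy i)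
  zero_mem' _ := R.zero_mem
  smul_mem' c x hx i := by
    rw [mem_R_iff]
    intro k hk
    have := (mem_R_iff _).1 (hx i) k hk
    simp [this]

/-- `R_-^n = ℝ^n[t⁻¹]t⁻¹` in `F^n`: vectors all of whose terms have negative degree in `t`. -/
def negR (n : ℕ) : Submodule ℝ (Fin n → F) where
  carrier := {x | ∀ i, ∀ k : ℤ, 0 ≤ k → (x i).coeff k = 0}
  add_mem' hx hy i k hk := by simp [hx i k hk, hy i k hk]
  zero_mem' _ _ _ := by simp
  smul_mem' c x hx i k hk := by simp [hx i k hk]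

theorem isCompl_latR_negR (n : ℕ) : IsCompl (latR n) (negR n) := by
  constructor
  · rw [Submodule.disjoint_def]
    intro x hx hy
    funext i
    ext k
    rcases lt_or_ge k 0 with hk | hk
    · exact (mem_R_iff _).1 (hx i) k hk
    · exact hy i k hk
  · rw [codisjoint_iff, Submodule.eq_top_iff']
    intro x
    let y : Fin n → F := fun i =>
      HahnSeries.ofPowerSeries ℤ ℝ (PowerSeries.mk fun m => (x i).coeff m)
    have hy : y ∈ latR n := fun i => ⟨_, rfl⟩
    have hz : x - y ∈ negR n := by
      intro i k hk
      lift k to ℕ using hk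
      simp [y]
    have := Submodule.add_mem_sup hy hz
    simpa using this

/-- The quotient `F^n / R^n`. -/
abbrev Quo (n : ℕ) : Type := (Fin n → F) ⧸ latR n

/-- The class in `F^n / R^n` of a vector in `F^n`. -/
abbrev cls {n : ℕ} : (Fin n → F) →ₗ[ℝ] Quo n := (latR n).mkQ

/-- `R_-^n = ℝ^n[t⁻¹]t⁻¹` as a real vector space. -/
def RNeg (n : ℕ) : Type := negR n

instance {n : ℕ} : AddCommGroup (RNeg n) := inferInstanceAs (AddCommGroup (negR n))

instance {n : ℕ} : Module ℝ (RNeg n) := inferInstanceAs (Module ℝ (negR n))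

/-- The inclusion `R_-^n → F^n`. -/
def toFn {n : ℕ} : RNeg n →ₗ[ℝ] (Fin n → F) := (negR n).subtype

/-- The isomorphism `F^n / R^n ≃ R_-^n` induced by the decomposition `F^n = R^n ⊕ R_-^n`. -/
def quoEquiv (n : ℕ) : Quo n ≃ₗ[ℝ] RNeg n :=
  Submodule.quotientEquivOfIsCompl (latR n) (negR n) (isCompl_latR_negR n)

/-- The representative in `R_-^n ⊆ F^n` of a class in `F^n / R^n`. -/
def rep {n : ℕ} : Quo n →ₗ[ℝ] (Fin n → F) := toFn ∘ₗ (quoEquiv n).toLinearMap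

theorem cls_rep {n : ℕ} (q : Quo n) : cls (rep q) = q :=
  Submodule.mk_quotientEquivOfIsCompl_apply (isCompl_latR_negR n) q

/-- The action of `g ∈ GL_n(F)` on column vectors, `x ↦ g x`. -/
def act {n : ℕ} (g : GL (Fin n) F) : (Fin n → F) →ₗ[ℝ] (Fin n → F) where
  toFun x := (g : Matrix (Fin n) (Fin n) F).mulVec x
  map_add' x y := Matrix.mulVec_add _ x y
  map_smul' c x := by
    funext i
    simp only [Matrix.mulVec, dotProduct, Pi.smul_apply, RingHom.id_apply, Finset.smul_sum,
      ← HahnSeries.C_mul_eq_smul]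
    exact Finset.sum_congr rfl fun j _ => by ring

theorem act_apply {n : ℕ} (g : GL (Fin n) F) (x : Fin n → F) :
    act g x = (g : Matrix (Fin n) (Fin n) F).mulVec x := rfl

theorem act_mul {n : ℕ} (g h : GL (Fin n) F) (x : Fin n → F) :
    act (g * h) x = act g (act h x) := by
  simp [act_apply, Matrix.mulVec_mulVec]

theorem act_one {n : ℕ} (x : Fin n → F) : act (1 : GL (Fin n) F) x = x := by
  simp [act_apply]

theorem act_inv_act {n : ℕ} (g : GL (Fin n) F) (x : Fin n → F) : act g⁻¹ (act g x) = x := by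
  rw [← act_mul, inv_mul_cancel, act_one]

theorem act_act_inv {n : ℕ} (g : GL (Fin n) F) (x : Fin n → F) : act g (act g⁻¹ x) = x := by
  rw [← act_mul, mul_inv_cancel, act_one]

/-- The semigroup `M_n'(R)` of `n × n` matrices with entries in `R` and non-zero determinant,
as a submonoid of `GL_n(F)`. -/
def MInt (n : ℕ) : Submonoid (GL (Fin n) F) where
  carrier := {g | ∀ i j, (g : Matrix (Fin n) (Fin n) F) i j ∈ R}
  one_mem' i j := by
    rw [Units.val_one, Matrix.one_apply]
    split_ifs
    · exact R.one_mem
    · exact R.zero_mem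
  mul_mem' {g h} hg hh i j := by
    rw [Units.val_mul, Matrix.mul_apply]
    exact R.sum_mem fun k _ => R.mul_mem (hg i k) (hh k j)

theorem act_mem_latR {n : ℕ} (g : MInt n) {x : Fin n → F} (hx : x ∈ latR n) :
    act (g : GL (Fin n) F) x ∈ latR n := by
  intro i
  change ∑ k, ((g : GL (Fin n) F) : Matrix (Fin n) (Fin n) F) i k * x k ∈ R
  exact R.sum_mem fun k _ => R.mul_mem (g.2 i k) (hx k)

/-- The subspace `V_g = g⁻¹R^n / R^n` of `F^n / R^n`. -/
def subV {n : ℕ} (g : MInt n) : Submodule ℝ (Quo n) :=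
  ((latR n).map (act (g : GL (Fin n) F)⁻¹)).map cls

theorem cls_mem_subV {n : ℕ} (g : MInt n) (x : Fin n → F) :
    cls x ∈ subV g ↔ act (g : GL (Fin n) F) x ∈ latR n := by
  constructor
  · rintro ⟨_, ⟨y, hy, rfl⟩, h⟩
    have h1 : act (g : GL (Fin n) F)⁻¹ y - x ∈ latR n := (Submodule.Quotient.eq _).1 h
    have h2 := act_mem_latR g h1
    rw [map_sub, act_act_inv] at h2
    have := (latR n).sub_mem hy h2
    simpa using this
  · intro h
    exact ⟨x, ⟨_, h, act_inv_act _ _⟩, rfl⟩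

theorem mem_subV {n : ℕ} (g : MInt n) (q : Quo n) :
    q ∈ subV g ↔ act (g : GL (Fin n) F) (rep q) ∈ latR n := by
  rw [← cls_mem_subV, cls_rep]

/-- For integers `k`, the unit `t^k` of `F`. -/
def tPow (k : ℤ) : Fˣ where
  val := HahnSeries.single k 1
  inv := HahnSeries.single (-k) 1
  val_inv := by simp
  inv_val := by simp

/-- The matrix `t^k I_n` in `GL_n(F)`. -/
def tGL (n : ℕ) (k : ℤ) : GL (Fin n) F := Matrix.GeneralLinearGroup.scalar (Fin n) (tPow k)

theorem tGL_add (n : ℕ) (k l : ℤ) : tGL n (k + l) = tGL n k * tGL n l := by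
  rw [tGL, tGL, tGL, ← map_mul]
  congr 1
  ext1
  simp [tPow]

theorem tGL_zero (n : ℕ) : tGL n 0 = 1 := by
  rw [tGL, ← map_one (Matrix.GeneralLinearGroup.scalar (Fin n))]
  congr 1

theorem tGL_comm {n : ℕ} (k : ℤ) (g : GL (Fin n) F) : tGL n k * g = g * tGL n k :=
  Matrix.GeneralLinearGroup.scalar_commute _ _

theorem tGL_apply (n : ℕ) (k : ℤ) (i j : Fin n) :
    (tGL n k : Matrix (Fin n) (Fin n) F) i j = if i = j then HahnSeries.single k 1 else 0 := by
  simp [tGL, tPow, Matrix.diagonal_apply]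

theorem act_tGL_coeff {n : ℕ} (k : ℤ) (x : Fin n → F) (i : Fin n) (m : ℤ) :
    (act (tGL n k) x i).coeff (m + k) = (x i).coeff m := by
  have : act (tGL n k) x i = HahnSeries.single k 1 * x i := by
    simp [act_apply, Matrix.mulVec, dotProduct, tGL_apply]
  rw [this, HahnSeries.coeff_single_mul_add, one_mul]

/-- The matrix `t^l I_n` in `M_n'(R)`, for `l ≥ 0`. -/
def tInt (n : ℕ) (l : ℕ) : MInt n := ⟨tGL n l, fun i j => by
  rw [tGL_apply, mem_R_iff]
  intro k hk
  split_ifs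
  · rw [HahnSeries.coeff_single_of_ne]; omega
  · simp⟩

/-- The linear map sending coordinates `(c_{i,j})` to `∑ c_{i,j} t^{-(i+1)} e_j`. -/
def negVec (n l : ℕ) : (Fin l × Fin n → ℝ) →ₗ[ℝ] (Fin n → F) where
  toFun c j := ∑ i : Fin l, HahnSeries.single (-((i : ℤ) + 1)) (c (i, j))
  map_add' c d := by
    funext j
    simp [Finset.sum_add_distrib]
  map_smul' a c := by
    funext j
    ext k
    simp only [HahnSeries.coeff_sum, Pi.smul_apply, HahnSeries.coeff_smul, RingHom.id_apply,
      Finset.smul_sum]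
    refine Finset.sum_congr rfl fun i _ => ?_
    by_cases h : k = -((i : ℤ) + 1)
    · subst h
      simp
    · rw [HahnSeries.coeff_single_of_ne h, HahnSeries.coeff_single_of_ne h, smul_zero]

theorem negVec_coeff (n l : ℕ) (c : Fin l × Fin n → ℝ) (j : Fin n) (i : Fin l) :
    (negVec n l c j).coeff (-((i : ℤ) + 1)) = c (i, j) := by
  simp only [negVec, LinearMap.coe_mk, AddHom.coe_mk, HahnSeries.coeff_sum]
  rw [Finset.sum_eq_single i]
  · simp
  · intro b _ hb
    apply HahnSeries.coeff_single_of_ne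
    intro h
    apply hb
    ext
    omega
  · simp

theorem negVec_coeff_eq_zero (n l : ℕ) (c : Fin l × Fin n → ℝ) (j : Fin n) (k : ℤ)
    (hk : 0 ≤ k ∨ k < -(l : ℤ)) : (negVec n l c j).coeff k = 0 := by
  simp only [negVec, LinearMap.coe_mk, AddHom.coe_mk, HahnSeries.coeff_sum]
  apply Finset.sum_eq_zero
  intro i _
  apply HahnSeries.coeff_single_of_ne
  have := i.2
  omega

theorem mem_subV_tInt {n : ℕ} (l : ℕ) (x : Fin n → F) :
    cls x ∈ subV (tInt n l) ↔ ∀ i, ∀ k : ℤ, k < -(l : ℤ) → (x i).coeff k = 0 := by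
  rw [cls_mem_subV]
  constructor
  · intro h i k hk
    have := (mem_R_iff _).1 (h i) (k + l) (by omega)
    rwa [show ((tInt n l : MInt n) : GL (Fin n) F) = tGL n l from rfl, act_tGL_coeff] at this
  · intro h i
    rw [mem_R_iff]
    intro k hk
    have := act_tGL_coeff (l : ℤ) x i (k - l)
    rw [sub_add_cancel] at this
    exact this.trans (h i _ (by omega))

/-- The coordinates on `V_{t^l I_n}` in the basis `t^{-i} e_j`, `1 ≤ i ≤ l`, `1 ≤ j ≤ n`. -/
def coordT (n l : ℕ) : (Fin l × Fin n → ℝ) ≃ₗ[ℝ] subV (tInt n l) :=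
  LinearEquiv.ofBijective
    (LinearMap.codRestrict (subV (tInt n l)) (cls ∘ₗ negVec n l) fun c =>
      (mem_subV_tInt l _).2 fun i k hk => negVec_coeff_eq_zero n l c i k (Or.inr hk)) (by
    constructor
    · rw [← LinearMap.ker_eq_bot, LinearMap.ker_eq_bot']
      intro c hc
      have h1 : cls (negVec n l c) = 0 := congrArg Subtype.val hc
      have h2 : negVec n l c ∈ latR n := (Submodule.Quotient.mk_eq_zero _).1 h1
      funext ⟨i, j⟩
      rw [← negVec_coeff n l c j i]
      exact (mem_R_iff _).1 (h2 j) _ (by omega)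
    · rintro ⟨q, hq⟩
      obtain ⟨x, rfl⟩ := (latR n).mkQ_surjective q
      have hx := (mem_subV_tInt l x).1 hq
      refine ⟨fun p => (x p.2).coeff (-((p.1 : ℤ) + 1)), Subtype.ext ?_⟩
      refine (Submodule.Quotient.eq _).2 fun j => ?_
      rw [mem_R_iff]
      intro k hk
      rw [Pi.sub_apply, HahnSeries.coeff_sub]
      rcases lt_or_ge k (-(l : ℤ)) with hkl | hkl
      · rw [hx j k hkl, negVec_coeff_eq_zero _ _ _ _ _ (Or.inr hkl), sub_zero]
      · obtain ⟨i, hi⟩ : ∃ i : Fin l, k = -((i : ℤ) + 1) :=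
          ⟨⟨(-k - 1).toNat, by omega⟩, by simp; omega⟩
        rw [hi, negVec_coeff, sub_self])

theorem finite_subV {n : ℕ} (g : MInt n) : FiniteDimensional ℝ (subV g) := by
  set A : Matrix (Fin n) (Fin n) F := ((g : GL (Fin n) F) : Matrix (Fin n) (Fin n) F) with hA
  have hdet : A.det ≠ 0 := (Matrix.GeneralLinearGroup.det (g : GL (Fin n) F)).ne_zero
  have hadj : ∀ i j, A.adjugate i j ∈ R := by
    have : ∃ B : Matrix (Fin n) (Fin n) R, A = B.map R.subtype := ⟨fun i j => ⟨A i j, g.2 i j⟩, rfl⟩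
    obtain ⟨B, hB⟩ := this
    intro i j
    have h := (RingHom.map_adjugate R.subtype B)
    rw [RingHom.mapMatrix_apply, RingHom.mapMatrix_apply] at h
    rw [hB, ← h]
    exact (B.adjugate i j).2
  have hle : subV g ≤ subV (tInt n A.det.order.toNat) := by
    intro q hq
    obtain ⟨x, rfl⟩ := (latR n).mkQ_surjective q
    rw [mem_subV_tInt]
    have hx : A.mulVec x ∈ latR n := (cls_mem_subV g x).1 hq
    intro i k hk
    have h1 : A.det * x i ∈ R := by
      have : A.adjugate.mulVec (A.mulVec x) i = A.det * x i := by
        rw [Matrix.mulVec_mulVec, Matrix.adjugate_mul, Matrix.smul_mulVec, Matrix.one_mulVec]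
        rfl
      rw [← this]
      change ∑ j, A.adjugate i j * A.mulVec x j ∈ R
      exact R.sum_mem fun j _ => R.mul_mem (hadj i j) (hx j)
    by_contra hne
    have hxi : x i ≠ 0 := fun h => hne (by simp [h])
    have hord : (A.det * x i).order = A.det.order + (x i).order := HahnSeries.order_mul hdet hxi
    have hle := HahnSeries.order_le_of_coeff_ne_zero hne
    have h0 := (mem_R_iff _).1 h1 (A.det * x i).order (by omega)
    rw [← HahnSeries.leadingCoeff_eq, HahnSeries.leadingCoeff_eq_zero] at h0
    exact mul_ne_zero hdet hxi h0
  have : FiniteDimensional ℝ (subV (tInt n A.det.order.toNat)) :=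
    (coordT n _).finiteDimensional
  exact Submodule.finiteDimensional_of_le hle

/-- `V_g = g⁻¹R^n / R^n` as a real vector space with its standard (finite-dimensional real)
topology and Borel σ-algebra. -/
def V {n : ℕ} (g : MInt n) : Type := subV g

instance {n : ℕ} (g : MInt n) : AddCommGroup (V g) := inferInstanceAs (AddCommGroup (subV g))

instance {n : ℕ} (g : MInt n) : Module ℝ (V g) := inferInstanceAs (Module ℝ (subV g))

instance {n : ℕ} (g : MInt n) : FiniteDimensional ℝ (V g) := finite_subV g

instance {n : ℕ} (g : MInt n) : TopologicalSpace (V g) := moduleTopology ℝ (V g)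

instance {n : ℕ} (g : MInt n) : IsModuleTopology ℝ (V g) := ⟨rfl⟩

instance {n : ℕ} (g : MInt n) : MeasurableSpace (V g) := borel (V g)

instance {n : ℕ} (g : MInt n) : BorelSpace (V g) := ⟨rfl⟩

instance {n : ℕ} (g : MInt n) : IsTopologicalAddGroup (V g) :=
  IsModuleTopology.topologicalAddGroup ℝ (V g)

/-- The inclusion `V_g → F^n / R^n`. -/
def incl {n : ℕ} (g : MInt n) : V g →ₗ[ℝ] Quo n := (subV g).subtype

theorem incl_injective {n : ℕ} (g : MInt n) : Function.Injective (incl g) :=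
  Subtype.val_injective

theorem incl_mem {n : ℕ} (g : MInt n) (v : V g) : incl g v ∈ subV g := v.2

/-- Linear equivalences between real vector spaces with their module topologies are continuous. -/
def toCLE {A B : Type*} [AddCommGroup A] [Module ℝ A] [TopologicalSpace A] [IsModuleTopology ℝ A]
    [AddCommGroup B] [Module ℝ B] [TopologicalSpace B] [IsModuleTopology ℝ B] (e : A ≃ₗ[ℝ] B) :
    A ≃L[ℝ] B where
  toLinearEquiv := e
  continuous_toFun := by
    have := IsModuleTopology.toContinuousAdd ℝ B
    exact IsModuleTopology.continuous_of_linearMap e.toLinearMap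
  continuous_invFun := by
    have := IsModuleTopology.toContinuousAdd ℝ A
    exact IsModuleTopology.continuous_of_linearMap e.symm.toLinearMap

/-- Coordinates on `V_g` in some basis. -/
def coordV {n : ℕ} (g : MInt n) : V g ≃L[ℝ] (Fin (Module.finrank ℝ (V g)) → ℝ) :=
  toCLE (Module.finBasis ℝ (V g)).equivFun

instance {n : ℕ} (g : MInt n) : T2Space (V g) :=
  (coordV g).toHomeomorph.isEmbedding.t2Space

instance {n : ℕ} (g : MInt n) : SecondCountableTopology (V g) :=
  (coordV g).toHomeomorph.secondCountableTopology

instance {n : ℕ} (g : MInt n) : LocallyCompactSpace (V g) :=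
  (coordV g).toHomeomorph.isClosedEmbedding.locallyCompactSpace

/-- The linear isomorphism `V_{g₁} × V_{g₂} ≃ V_{g₁g₂}`, `(y, z) ↦ g₂⁻¹y + z`, where `y` stands for
its representative in `R_-^n`; it splits the exact sequence
`0 → g₂⁻¹R^n/R^n → g₂⁻¹g₁⁻¹R^n/R^n → g₂⁻¹g₁⁻¹R^n/g₂⁻¹R^n ≅ V_{g₁} → 0`. -/
def convEquiv {n : ℕ} (g₁ g₂ : MInt n) : (V g₁ × V g₂) ≃ₗ[ℝ] V (g₁ * g₂) :=
  LinearEquiv.ofBijective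
    (LinearMap.codRestrict (subV (g₁ * g₂))
      ((cls ∘ₗ act (g₂ : GL (Fin n) F)⁻¹ ∘ₗ rep ∘ₗ incl g₁).coprod (incl g₂)) (by
        rintro ⟨y, z⟩
        refine (subV (g₁ * g₂)).add_mem ?_ ?_
        · refine (cls_mem_subV _ _).2 ?_
          rw [Submonoid.coe_mul, act_mul]
          change act _ (act _ (act _ (rep (incl g₁ y)))) ∈ _
          rw [act_act_inv]
          exact (mem_subV _ _).1 (incl_mem g₁ y)
        · refine (mem_subV _ _).2 ?_
          rw [Submonoid.coe_mul, act_mul]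
          exact act_mem_latR g₁ ((mem_subV _ _).1 (incl_mem g₂ z)))) (by
    constructor
    · rw [← LinearMap.ker_eq_bot, LinearMap.ker_eq_bot']
      rintro ⟨y, z⟩ h
      have h1 : cls (act (g₂ : GL (Fin n) F)⁻¹ (rep (incl g₁ y))) + incl g₂ z = 0 :=
        congrArg Subtype.val h
      have h2 : cls (act (g₂ : GL (Fin n) F)⁻¹ (rep (incl g₁ y))) ∈ subV g₂ := by
        rw [eq_neg_of_add_eq_zero_left h1]
        exact (subV g₂).neg_mem (incl_mem g₂ z)
      rw [cls_mem_subV, act_act_inv] at h2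
      have h3 : incl g₁ y = 0 := by
        rw [← cls_rep (incl g₁ y)]
        exact (Submodule.Quotient.mk_eq_zero _).2 h2
      have hy : y = 0 := incl_injective g₁ (by rw [h3, map_zero])
      have hz : z = 0 := incl_injective g₂ (by
        rw [h3, map_zero, map_zero, map_zero, zero_add] at h1
        rw [h1, map_zero])
      rw [hy, hz]
      rfl
    · rintro ⟨q, hq⟩
      obtain ⟨x, rfl⟩ := (latR n).mkQ_surjective q
      have hx : act ((g₁ * g₂ : MInt n) : GL (Fin n) F) x ∈ latR n := (cls_mem_subV _ _).1 hq
      rw [Submonoid.coe_mul, act_mul] at hx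
      let y : V g₁ := ⟨cls (act (g₂ : GL (Fin n) F) x), (cls_mem_subV _ _).2 hx⟩
      have hy : rep (incl g₁ y) - act (g₂ : GL (Fin n) F) x ∈ latR n :=
        (Submodule.Quotient.eq _).1 (cls_rep (incl g₁ y))
      let z : V g₂ := ⟨cls (x - act (g₂ : GL (Fin n) F)⁻¹ (rep (incl g₁ y))), by
        rw [cls_mem_subV, map_sub, act_act_inv, ← neg_sub]
        exact (latR n).neg_mem hy⟩
      refine ⟨(y, z), Subtype.ext ?_⟩
      change cls (act (g₂ : GL (Fin n) F)⁻¹ (rep (incl g₁ y))) +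
        cls (x - act (g₂ : GL (Fin n) F)⁻¹ (rep (incl g₁ y))) = cls x
      rw [← map_add]
      congr 1
      abel)

theorem incl_convEquiv {n : ℕ} (g₁ g₂ : MInt n) (y : V g₁) (z : V g₂) :
    incl (g₁ * g₂) (convEquiv g₁ g₂ (y, z)) =
      cls (act (g₂ : GL (Fin n) F)⁻¹ (rep (incl g₁ y))) + incl g₂ z := rfl

/-- The pairs `(g, μ)` with `g ∈ M_n'(R)` and `μ` a Haar measure on `V_g`. -/
structure MHat (n : ℕ) where
  /-- the matrix -/
  g : MInt n
  /-- the measure -/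
  μ : Measure (V g)
  haar : μ.IsAddHaarMeasure

attribute [instance] MHat.haar

/-- The Haar measure `μ₁ * μ₂` on `V_{g₁g₂}`:
`∫ f d(μ₁ * μ₂) = ∫_{V_{g₁}} ∫_{V_{g₂}} f(g₂⁻¹y + z) μ₂(dz) μ₁(dy)`. -/
def conv {n : ℕ} (α β : MHat n) : Measure (V (α.g * β.g)) :=
  (α.μ.prod β.μ).map (convEquiv α.g β.g)

instance {n : ℕ} (α β : MHat n) : (conv α β).IsAddHaarMeasure :=
  (toCLE (convEquiv α.g β.g)).isAddHaarMeasure_map (α.μ.prod β.μ)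

instance {n : ℕ} : Mul (MHat n) := ⟨fun α β => ⟨α.g * β.g, conv α β, inferInstance⟩⟩

theorem MHat.mul_g {n : ℕ} (α β : MHat n) : (α * β).g = α.g * β.g := rfl

theorem measurable_linear {n : ℕ} {g h : MInt n} (L : V g →ₗ[ℝ] V h) : Measurable L :=
  (IsModuleTopology.continuous_of_linearMap L).measurable

theorem measurable_convEquiv {n : ℕ} (g h : MInt n) : Measurable (convEquiv g h) :=
  (toCLE (convEquiv g h)).continuous.measurable

theorem lintegral_mul {n : ℕ} (α β : MHat n) (φ : Quo n → ENNReal)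
    (hφ : Measurable fun v : V (α.g * β.g) => φ (incl _ v)) :
    ∫⁻ v, φ (incl _ v) ∂(α * β).μ = ∫⁻ y, ∫⁻ z,
      φ (cls (act (β.g : GL (Fin n) F)⁻¹ (rep (incl α.g y))) + incl β.g z) ∂β.μ ∂α.μ := by
  change ∫⁻ v, φ (incl (α.g * β.g) v) ∂((α.μ.prod β.μ).map (convEquiv α.g β.g)) = _
  rw [lintegral_map hφ (measurable_convEquiv _ _),
    lintegral_prod (fun p => φ (incl (α.g * β.g) (convEquiv α.g β.g p)))
      (hφ.comp (measurable_convEquiv _ _)).aemeasurable]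
  rfl

/-- The defining formula of `μ₁ * μ₂` on integrable functions. -/
theorem integral_conv {n : ℕ} (α β : MHat n) (f : V (α.g * β.g) → ℂ)
    (hf : Integrable f (conv α β)) :
    ∫ v, f v ∂(conv α β) = ∫ y, ∫ z, f (convEquiv α.g β.g (y, z)) ∂β.μ ∂α.μ := by
  have h1 : MeasurableEmbedding (convEquiv α.g β.g) :=
    (toCLE (convEquiv α.g β.g)).toHomeomorph.measurableEmbedding
  rw [conv, h1.integrable_map_iff] at hf
  rw [conv, h1.integral_map, integral_prod (fun p => f (convEquiv α.g β.g p)) hf]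

theorem MHat.ext_lintegral {n : ℕ} {α β : MHat n} (hg : α.g = β.g)
    (h : ∀ φ : Quo n → ENNReal, Measurable (fun v : V α.g => φ (incl _ v)) →
      ∫⁻ v, φ (incl _ v) ∂α.μ = ∫⁻ v, φ (incl _ v) ∂β.μ) : α = β := by
  obtain ⟨g, μ, hμ⟩ := α
  obtain ⟨g', ν, hν⟩ := β
  obtain rfl : g = g' := hg
  have : μ = ν := by
    refine Measure.ext_of_lintegral _ fun f hf => ?_
    have hfe : (fun v : V g => Function.extend (incl g) f 0 (incl g v)) = f := by
      funext v
      exact (incl_injective g).extend_apply f 0 v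
    have := h (Function.extend (incl g) f 0) (by simpa only [hfe] using hf)
    simpa only [(incl_injective g).extend_apply] using this
  subst this
  rfl

theorem measurable_congr {n : ℕ} {g h : MInt n} (e : g = h) {φ : Quo n → ENNReal}
    (hφ : Measurable fun v : V g => φ (incl g v)) : Measurable fun v : V h => φ (incl h v) := by
  subst e
  exact hφ

/-- Translating the argument of `g⁻¹` by a lattice vector moves the result inside `V_g`. -/
theorem exists_incl_rep {n : ℕ} (g : MInt n) (x : Fin n → F) :
    ∃ u : V g, cls (act (g : GL (Fin n) F)⁻¹ (rep (cls x))) =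
      cls (act (g : GL (Fin n) F)⁻¹ x) + incl g u := by
  have hx : rep (cls x) - x ∈ latR n := (Submodule.Quotient.eq _).1 (cls_rep (cls x))
  refine ⟨⟨cls (act (g : GL (Fin n) F)⁻¹ (rep (cls x) - x)), ?_⟩, ?_⟩
  · rw [cls_mem_subV, act_act_inv]
    exact hx
  · change _ = _ + cls _
    rw [← map_add, ← map_add]
    congr 2
    abel

theorem MHat.mul_assoc' {n : ℕ} (α β γ : MHat n) : α * β * γ = α * (β * γ) := by
  refine MHat.ext_lintegral (mul_assoc α.g β.g γ.g) fun φ hφ => ?_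
  have hφ' := measurable_congr (mul_assoc α.g β.g γ.g) hφ
  let ψ : Quo n → ENNReal := fun q =>
    ∫⁻ w, φ (cls (act (γ.g : GL (Fin n) F)⁻¹ (rep q)) + incl γ.g w) ∂γ.μ
  have hψ : Measurable fun v : V (α.g * β.g) => ψ (incl _ v) := by
    have h1 : Measurable fun p : V (α.g * β.g) × V γ.g =>
        φ (incl (α.g * β.g * γ.g) (convEquiv (α.g * β.g) γ.g p)) :=
      hφ.comp (measurable_convEquiv _ _)
    exact h1.lintegral_prod_right' (ν := γ.μ)
  refine (lintegral_mul (α * β) γ φ hφ).trans ((lintegral_mul α β ψ hψ).trans ?_)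
  refine Eq.trans ?_ (lintegral_mul α (β * γ) φ hφ').symm
  refine lintegral_congr fun y => ?_
  let c : Quo n := cls (act ((β.g * γ.g : MInt n) : GL (Fin n) F)⁻¹ (rep (incl α.g y)))
  have hc : Measurable fun v : V (β.g * γ.g) => φ (c + incl _ v) := by
    have h2 : Measurable fun v : V (β.g * γ.g) =>
        φ (incl (α.g * (β.g * γ.g)) (convEquiv α.g (β.g * γ.g) (y, v))) :=
      (hφ'.comp (measurable_convEquiv _ _)).comp measurable_prodMk_left
    exact h2
  refine Eq.trans ?_ (lintegral_mul β γ (fun q => φ (c + q)) hc).symm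
  refine lintegral_congr fun z => ?_
  obtain ⟨u, hu⟩ := exists_incl_rep γ.g (act (β.g : GL (Fin n) F)⁻¹ (rep (incl α.g y)))
  change ∫⁻ w, φ (cls (act (γ.g : GL (Fin n) F)⁻¹ (rep (cls
    (act (β.g : GL (Fin n) F)⁻¹ (rep (incl α.g y))) + incl β.g z))) + incl γ.g w) ∂γ.μ = _
  rw [← lintegral_add_left_eq_self
    (fun w => φ (c + (cls (act (γ.g : GL (Fin n) F)⁻¹ (rep (incl β.g z))) + incl γ.g w))) u]
  refine lintegral_congr fun w => ?_
  have hc' : c = cls (act (γ.g : GL (Fin n) F)⁻¹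
      (act (β.g : GL (Fin n) F)⁻¹ (rep (incl α.g y)))) := by
    rw [← act_mul, ← mul_inv_rev]
    rfl
  rw [map_add, map_add, map_add, hu, ← hc', map_add]
  congr 1
  abel

/-- `V_{I_n}` is the zero space. -/
instance {n : ℕ} : Unique (V (1 : MInt n)) where
  default := 0
  uniq v := by
    refine incl_injective _ ?_
    have h := (mem_subV _ _).1 (incl_mem _ v)
    rw [Submonoid.coe_one, act_one] at h
    rw [map_zero, ← cls_rep (incl _ v)]
    exact (Submodule.Quotient.mk_eq_zero _).2 h

theorem isAddHaar_count {n : ℕ} :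
    (Measure.count : Measure (V (1 : MInt n))).IsAddHaarMeasure where
  lt_top_of_isCompact K _ :=
    lt_of_le_of_lt (measure_mono (Set.subset_univ K)) (by simp [Measure.count_univ])
  map_add_left_eq_self g := by
    have : (fun x : V (1 : MInt n) => g + x) = id := funext fun x => Subsingleton.elim _ _
    rw [this, Measure.map_id]
  open_pos U _ hne := by
    rw [Set.Nonempty.eq_univ hne, Measure.count_univ]
    simp

instance {n : ℕ} : One (MHat n) := ⟨⟨1, Measure.count, isAddHaar_count⟩⟩

theorem MHat.one_mul' {n : ℕ} (α : MHat n) : 1 * α = α := by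
  refine MHat.ext_lintegral (one_mul α.g) fun φ hφ => ?_
  rw [lintegral_mul 1 α φ hφ]
  change ∫⁻ y : V (1 : MInt n), _ ∂Measure.count = _
  rw [lintegral_unique, Measure.count_univ]
  have h0 : (default : V (1 : MInt n)) = 0 := rfl
  change (∫⁻ z, φ (cls (act (α.g : GL (Fin n) F)⁻¹ (rep (incl (1 : MInt n) default))) +
    incl α.g z) ∂α.μ) * _ = _
  simp [h0, -Submodule.mkQ_apply]

theorem MHat.mul_one' {n : ℕ} (α : MHat n) : α * 1 = α := by
  refine MHat.ext_lintegral (mul_one α.g) fun φ hφ => ?_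
  rw [lintegral_mul α 1 φ hφ]
  refine lintegral_congr fun y => ?_
  change ∫⁻ z : V (1 : MInt n), φ (cls (act ((1 : MInt n) : GL (Fin n) F)⁻¹ (rep (incl α.g y))) +
    incl (1 : MInt n) z) ∂Measure.count = _
  rw [lintegral_unique, Measure.count_univ]
  have h0 : (default : V (1 : MInt n)) = 0 := rfl
  rw [h0, map_zero, add_zero, Submonoid.coe_one, inv_one, act_one, cls_rep]
  simp

/-- The semigroup of pairs `(g, μ)` under `(g₁, μ₁)(g₂, μ₂) = (g₁g₂, μ₁ * μ₂)`; its identity is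
`I_n` with the counting measure. -/
instance {n : ℕ} : Monoid (MHat n) where
  mul_assoc := MHat.mul_assoc'
  one_mul := MHat.one_mul'
  mul_one := MHat.mul_one'

/-- The measure `μ_st` on `V_{t^l I_n}`: Lebesgue measure in the coordinates with respect to the
basis `t^{-i} e_j`, `1 ≤ i ≤ l`, `1 ≤ j ≤ n`. -/
def muSt (n l : ℕ) : Measure (V (tInt n l)) := Measure.map (coordT n l) volume

theorem isAddHaar_muSt (n l : ℕ) : (muSt n l).IsAddHaarMeasure :=
  (toCLE (show (Fin l × Fin n → ℝ) ≃ₗ[ℝ] V (tInt n l) from coordT n l)).isAddHaarMeasure_map volume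

/-- The element `(t^l I_n, μ_st)`. -/
def tHat (n l : ℕ) : MHat n := ⟨tInt n l, muSt n l, isAddHaar_muSt n l⟩

/-- `GL_n(F)_0`: the matrices whose determinant has leading coefficient `±1`. -/
def GL0 (n : ℕ) : Subgroup (GL (Fin n) F) where
  carrier := {g | (g : Matrix (Fin n) (Fin n) F).det.leadingCoeff = 1 ∨
    (g : Matrix (Fin n) (Fin n) F).det.leadingCoeff = -1}
  one_mem' := by simp
  mul_mem' {g h} hg hh := by
    simp only [Set.mem_ofPred_eq, Units.val_mul, Matrix.det_mul,
      HahnSeries.leadingCoeff_mul] at hg hh ⊢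
    rcases hg with hg | hg <;> rcases hh with hh | hh <;> simp [hg, hh]
  inv_mem' {g} hg := by
    simp only [Set.mem_ofPred_eq] at hg ⊢
    have h : (g : Matrix (Fin n) (Fin n) F).det.leadingCoeff *
        ((g⁻¹ : GL (Fin n) F) : Matrix (Fin n) (Fin n) F).det.leadingCoeff = 1 := by
      rw [← HahnSeries.leadingCoeff_mul, ← Matrix.det_mul, ← Units.val_mul, mul_inv_cancel]
      simp
    rcases hg with hg | hg
    · left
      rwa [hg, one_mul] at h
    · right
      rw [hg] at h
      linarith

theorem tGL_mem_GL0 (n : ℕ) (k : ℤ) : tGL n k ∈ GL0 n := by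
  left
  have h : (tGL n k : Matrix (Fin n) (Fin n) F) =
      Matrix.diagonal fun _ => (HahnSeries.single k 1 : F) := by
    ext1 i j
    rw [tGL_apply, Matrix.diagonal_apply]
  rw [h, Matrix.det_diagonal, Finset.prod_const, HahnSeries.single_pow,
    HahnSeries.leadingCoeff_of_single, one_pow]

/-- The subsemigroup of pairs `(g, μ)` with `g ∈ GL_n(F)_0 ∩ M_n'(R)`. -/
def MHat0 (n : ℕ) : Submonoid (MHat n) where
  carrier := {α | (α.g : GL (Fin n) F) ∈ GL0 n}
  one_mem' := (GL0 n).one_mem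
  mul_mem' hα hβ := (GL0 n).mul_mem hα hβ

/-- `(t^l I_n, μ_st)` as an element of `MHat0 n`. -/
def tHat0 (n l : ℕ) : MHat0 n := ⟨tHat n l, tGL_mem_GL0 n l⟩

/-- The direct product `{t^k I | k ∈ ℤ} × MHat0 n`. -/
abbrev GTilde (n : ℕ) : Type := Multiplicative ℤ × MHat0 n

/-- The relation `(t^{k+l}, α) ∼ (t^k, (t^l I_n, μ_st) α)` for `l ≥ 0`. -/
inductive TRel (n : ℕ) : GTilde n → GTilde n → Prop
  | intro (k : ℤ) (l : ℕ) (α : MHat0 n) :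
      TRel n (Multiplicative.ofAdd (k + l), α) (Multiplicative.ofAdd k, tHat0 n l * α)

/-- The equivalence relation, compatible with the product, that is induced by `TRel`. -/
def tCon (n : ℕ) : Con (GTilde n) := conGen (TRel n)

/-- The group `GL_n(F)_0^`, a central extension of `GL_n(F)_0`. -/
def GLHat (n : ℕ) : Type := (tCon n).Quotient

instance {n : ℕ} : Monoid (GLHat n) := inferInstanceAs (Monoid (tCon n).Quotient)

/-- The element of `GLHat n` represented by `(t^k, α)`. -/
def GLHat.mk {n : ℕ} (k : ℤ) (α : MHat0 n) : GLHat n :=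
  (((Multiplicative.ofAdd k, α) : GTilde n) : (tCon n).Quotient)

theorem GLHat.mk_mul_mk {n : ℕ} (k l : ℤ) (α β : MHat0 n) :
    GLHat.mk k α * GLHat.mk l β = GLHat.mk (k + l) (α * β) := rfl

theorem GLHat.mk_add {n : ℕ} (k : ℤ) (l : ℕ) (α : MHat0 n) :
    GLHat.mk (k + l) α = GLHat.mk k (tHat0 n l * α) :=
  (Con.eq _).2 (ConGen.Rel.of _ _ (TRel.intro k l α))

theorem GLHat.exists_mk {n : ℕ} (a : GLHat n) : ∃ k α, a = GLHat.mk k α := by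
  induction a using Con.induction_on with
  | H p => exact ⟨Multiplicative.toAdd p.1, p.2, rfl⟩

/-- The identity matrix with `c` times the counting measure. -/
def scalHat (n : ℕ) (c : ENNReal) (h0 : c ≠ 0) (ht : c ≠ ⊤) : MHat n :=
  ⟨1, c • Measure.count, by
    have := isAddHaar_count (n := n)
    exact Measure.IsAddHaarMeasure.smul _ h0 ht⟩

theorem lintegral_mul_scalHat {n : ℕ} (α : MHat n) (c : ENNReal) (h0 : c ≠ 0) (ht : c ≠ ⊤)
    (φ : Quo n → ENNReal) (hφ : Measurable fun v : V α.g => φ (incl _ v)) :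
    ∫⁻ v, φ (incl _ v) ∂(α * scalHat n c h0 ht).μ = c * ∫⁻ v, φ (incl _ v) ∂α.μ := by
  rw [lintegral_mul α (scalHat n c h0 ht) φ (measurable_congr (mul_one α.g).symm hφ),
    ← lintegral_const_mul _ hφ]
  refine lintegral_congr fun y => ?_
  change ∫⁻ z : V (1 : MInt n), φ (cls (act ((1 : MInt n) : GL (Fin n) F)⁻¹ (rep (incl α.g y))) +
    incl (1 : MInt n) z) ∂(c • Measure.count) = _
  have h0 : (default : V (1 : MInt n)) = 0 := rfl
  rw [lintegral_unique, Measure.smul_apply, Measure.count_univ,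
    h0, map_zero, add_zero, Submonoid.coe_one, inv_one, act_one, cls_rep]
  simp [mul_comm]

theorem exists_eq_mul_scalHat {n : ℕ} (α β : MHat n) (h : α.g = β.g) :
    ∃ (c : ENNReal) (h0 : c ≠ 0) (ht : c ≠ ⊤), α = β * scalHat n c h0 ht := by
  obtain ⟨g, μ, hμ⟩ := α
  obtain ⟨g', ν, hν⟩ := β
  obtain rfl : g = g' := h
  refine ⟨Measure.addHaarScalarFactor μ ν, ?_, ENNReal.coe_ne_top, ?_⟩
  · exact_mod_cast (Measure.addHaarScalarFactor_pos_of_isAddHaarMeasure μ ν).ne'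
  · refine MHat.ext_lintegral (mul_one g).symm fun φ hφ => ?_
    refine Eq.trans ?_ (lintegral_mul_scalHat ⟨g, ν, hν⟩ _ _ _ φ hφ).symm
    change ∫⁻ v, φ (incl g v) ∂μ = _ * ∫⁻ v, φ (incl g v) ∂ν
    conv_lhs => rw [Measure.isAddLeftInvariant_eq_smul μ ν]
    rw [lintegral_smul_measure]
    rfl

theorem scalHat_mul_inv (n : ℕ) (c : ENNReal) (h0 : c ≠ 0) (ht : c ≠ ⊤) :
    scalHat n c h0 ht * scalHat n c⁻¹ (ENNReal.inv_ne_zero.2 ht) (ENNReal.inv_ne_top.2 h0) = 1 := by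
  refine MHat.ext_lintegral (mul_one (1 : MInt n)) fun φ hφ => ?_
  refine (lintegral_mul_scalHat (scalHat n c h0 ht) c⁻¹ (ENNReal.inv_ne_zero.2 ht)
    (ENNReal.inv_ne_top.2 h0) φ (measurable_congr (mul_one (1 : MInt n)) hφ)).trans ?_
  have h1 : ∫⁻ v, φ (incl (1 : MInt n) v) ∂(c • Measure.count) =
      c * ∫⁻ v, φ (incl (1 : MInt n) v) ∂Measure.count := lintegral_smul_measure _ _
  refine (congrArg (c⁻¹ * ·) h1).trans ?_
  rw [← mul_assoc, ENNReal.inv_mul_cancel h0 ht, one_mul]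
  rfl

/-- Every matrix over `F` becomes integral after multiplication by a power of `t`. -/
theorem exists_tGL_mul_mem {n : ℕ} (g : GL (Fin n) F) : ∃ l : ℕ, tGL n l * g ∈ MInt n := by
  let A : Matrix (Fin n) (Fin n) F := g
  refine ⟨∑ p : Fin n × Fin n, (-(A p.1 p.2).order).toNat, fun i j => ?_⟩
  have hle : (-(A i j).order).toNat ≤ ∑ p : Fin n × Fin n, (-(A p.1 p.2).order).toNat :=
    Finset.single_le_sum (f := fun p : Fin n × Fin n => (-(A p.1 p.2).order).toNat)
      (fun _ _ => Nat.zero_le _) (Finset.mem_univ (i, j))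
  set l := ∑ p : Fin n × Fin n, (-(A p.1 p.2).order).toNat
  have h : ((tGL n l * g : GL (Fin n) F) : Matrix (Fin n) (Fin n) F) i j =
      HahnSeries.single (l : ℤ) 1 * A i j := by
    rw [Units.val_mul, Matrix.mul_apply]
    simp [tGL_apply, A]
  rw [h, mem_R_iff]
  intro k hk
  rw [← sub_add_cancel k (l : ℤ), HahnSeries.coeff_single_mul_add, one_mul]
  apply HahnSeries.coeff_eq_zero_of_lt_order
  omega

theorem GLHat.exists_mul_eq_one {n : ℕ} (a : GLHat n) : ∃ b : GLHat n, a * b = 1 := by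
  obtain ⟨k, α, rfl⟩ := GLHat.exists_mk a
  obtain ⟨l, hl⟩ := exists_tGL_mul_mem ((α.1.g : GL (Fin n) F)⁻¹)
  let β : MHat0 n := ⟨⟨⟨_, hl⟩, Measure.addHaar, inferInstance⟩,
    (GL0 n).mul_mem (tGL_mem_GL0 n l) ((GL0 n).inv_mem α.2)⟩
  have hg : (α.1 * β.1).g = (tHat n l).g := by
    refine Subtype.ext ?_
    change (α.1.g : GL (Fin n) F) * (tGL n l * (α.1.g : GL (Fin n) F)⁻¹) = tGL n l
    rw [tGL_comm, mul_inv_cancel_left]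
  obtain ⟨c, h0, ht, hc⟩ := exists_eq_mul_scalHat _ _ hg
  let s : MHat0 n := ⟨scalHat n c h0 ht, (GL0 n).one_mem⟩
  let s' : MHat0 n := ⟨scalHat n c⁻¹ (ENNReal.inv_ne_zero.2 ht) (ENNReal.inv_ne_top.2 h0),
    (GL0 n).one_mem⟩
  have hs : s * s' = 1 := Subtype.ext (scalHat_mul_inv n c h0 ht)
  have hαβ : α * β = tHat0 n l * s := Subtype.ext hc
  refine ⟨GLHat.mk (-k - l) β * GLHat.mk 0 s', ?_⟩
  rw [← mul_assoc, GLHat.mk_mul_mk, hαβ, ← GLHat.mk_add, GLHat.mk_mul_mk, hs]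
  have : k + (-k - (l : ℤ)) + l + 0 = 0 := by ring
  rw [this]
  rfl

instance {n : ℕ} : Group (GLHat n) := groupOfIsUnit fun a => by
  obtain ⟨b, hb⟩ := GLHat.exists_mul_eq_one a
  obtain ⟨c, hc⟩ := GLHat.exists_mul_eq_one b
  have : a = c := by rw [← mul_one a, ← hc, ← mul_assoc, hb, one_mul]
  subst this
  exact ⟨⟨a, b, hb, hc⟩, rfl⟩

/-- The homomorphism `GLHat n → GL_n(F)_0`, `(t^k, (g, μ)) ↦ t^k g`. -/
def GLHat.proj (n : ℕ) : GLHat n →* GL0 n :=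
  (tCon n).lift
    { toFun := fun p => ⟨tGL n (Multiplicative.toAdd p.1) * p.2.1.g,
        (GL0 n).mul_mem (tGL_mem_GL0 n _) p.2.2⟩
      map_one' := Subtype.ext (by
        change tGL n 0 * 1 = 1
        rw [tGL_zero, mul_one])
      map_mul' := fun p q => Subtype.ext (by
        change tGL n (Multiplicative.toAdd p.1 + Multiplicative.toAdd q.1) *
          ((p.2.1.g : GL (Fin n) F) * q.2.1.g) =
          tGL n (Multiplicative.toAdd p.1) * p.2.1.g * (tGL n (Multiplicative.toAdd q.1) * q.2.1.g)
        rw [tGL_add, mul_assoc, mul_assoc, ← mul_assoc (tGL n (Multiplicative.toAdd q.1)),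
          tGL_comm (Multiplicative.toAdd q.1) (p.2.1.g : GL (Fin n) F), mul_assoc]) }
    (Con.conGen_le.2 (by
      rintro _ _ ⟨k, l, α⟩
      refine Subtype.ext ?_
      change tGL n (k + l) * α.1.g = tGL n k * (tGL n l * α.1.g)
      rw [tGL_add, mul_assoc]))

/-- The inverse image of `SL_n(F)` in `GLHat n`. -/
def SLHat (n : ℕ) : Subgroup (GLHat n) :=
  ((Matrix.GeneralLinearGroup.det (n := Fin n) (R := F)).ker.comap (GL0 n).subtype).comap
    (GLHat.proj n)

/-- A function on `R_-^n` is a Schwartz function if its restriction to every finite-dimensional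
subspace `W` is a Schwartz function (in any linear coordinates on `W`). -/
def IsSchwartz {n : ℕ} (f : RNeg n → ℂ) : Prop :=
  ∀ (W : Submodule ℝ (RNeg n)) (m : ℕ) (e : EuclideanSpace ℝ (Fin m) ≃ₗ[ℝ] W),
    ∃ s : SchwartzMap (EuclideanSpace ℝ (Fin m)) ℂ, ∀ v, s v = f (e v : RNeg n)

/-- The space `S(R_-^n)` of Schwartz functions. -/
def schwartz (n : ℕ) : Submodule ℂ (RNeg n → ℂ) where
  carrier := {f | IsSchwartz f}
  add_mem' hf hg W m e := by
    obtain ⟨s, hs⟩ := hf W m e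
    obtain ⟨s', hs'⟩ := hg W m e
    exact ⟨s + s', fun v => by simp [hs, hs']⟩
  zero_mem' W m e := ⟨0, fun v => by simp⟩
  smul_mem' c f hf W m e := by
    obtain ⟨s, hs⟩ := hf W m e
    exact ⟨c • s, fun v => by simp [hs]⟩

/-- A function `f` on `R_-^n`, viewed as a function on `F^n / R^n`. -/
def onQuo {n : ℕ} (f : RNeg n → ℂ) : Quo n → ℂ := fun q => f (quoEquiv n q)

/-- A function `f` on `R_-^n`, viewed as an `R^n`-periodic function on `F^n`. -/
def onFn {n : ℕ} (f : RNeg n → ℂ) : (Fin n → F) → ℂ := fun x => onQuo f (cls x)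

/-- Schwartz functions are integrable on the translates of `V_g`. -/
theorem integrable_onQuo {n : ℕ} (α : MHat n) {f : RNeg n → ℂ} (hf : f ∈ schwartz n)
    (q : Quo n) : Integrable (fun y => onQuo f (q + incl α.g y)) α.μ := by
  let L : V α.g →ₗ[ℝ] RNeg n := (quoEquiv n).toLinearMap ∘ₗ incl α.g
  let W : Submodule ℝ (RNeg n) := Submodule.span ℝ {quoEquiv n q} ⊔ LinearMap.range L
  have hq : quoEquiv n q ∈ W :=
    Submodule.mem_sup_left (Submodule.mem_span_singleton_self _)
  have hL : ∀ y, L y ∈ W := fun y => Submodule.mem_sup_right ⟨y, rfl⟩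
  have hfin : FiniteDimensional ℝ W := Submodule.finiteDimensional_sup _ _
  let e : EuclideanSpace ℝ (Fin (Module.finrank ℝ W)) ≃ₗ[ℝ] W :=
    LinearEquiv.ofFinrankEq _ _ (by simp)
  obtain ⟨s, hs⟩ := hf W _ e
  let c : V α.g ≃L[ℝ] EuclideanSpace ℝ (Fin (Module.finrank ℝ (V α.g))) :=
    (coordV α.g).trans (EuclideanSpace.equiv _ ℝ).symm
  let M : EuclideanSpace ℝ (Fin (Module.finrank ℝ (V α.g))) →ₗ[ℝ]
      EuclideanSpace ℝ (Fin (Module.finrank ℝ W)) :=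
    e.symm.toLinearMap ∘ₗ (L.codRestrict W hL) ∘ₗ c.symm.toLinearEquiv.toLinearMap
  have hM : LinearMap.ker M = ⊥ := by
    rw [LinearMap.ker_eq_bot]
    exact e.symm.injective.comp fun y z h => c.symm.injective
      (incl_injective _ ((quoEquiv n).injective (congrArg Subtype.val h)))
  obtain ⟨K, -, hK⟩ := M.exists_antilipschitzWith hM
  let a := e.symm ⟨quoEquiv n q, hq⟩
  have hK' : AntilipschitzWith K fun v => a + M v := by
    intro x y
    rw [edist_add_left]
    exact hK x y
  have hT : Function.HasTemperateGrowth fun v => a + M v :=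
    (Function.HasTemperateGrowth.const a).add M.toContinuousLinearMap.hasTemperateGrowth
  have hint : Integrable (SchwartzMap.compCLMOfAntilipschitz ℝ hT hK' s) (α.μ.map c) :=
    SchwartzMap.integrable _
  have hc : MeasurableEmbedding c := c.toHomeomorph.measurableEmbedding
  rw [hc.integrable_map_iff] at hint
  refine hint.congr (Filter.Eventually.of_forall fun y => ?_)
  change s (a + M (c y)) = f (quoEquiv n (q + incl α.g y))
  rw [hs, map_add]
  congr 1
  simp [a, M, L]

/-- The operator `π(g, μ)`: `π(g, μ)f(x) = ∫_{V_g} f(g⁻¹x + y) μ(dy)`. -/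
def piOp {n : ℕ} (α : MHat n) (f : RNeg n → ℂ) : RNeg n → ℂ := fun x =>
  ∫ y, onQuo f (cls (act (α.g : GL (Fin n) F)⁻¹ (toFn x)) + incl α.g y) ∂α.μ

/-- The eigenspace `S(R_-^n)_λ = {f ∈ S(R_-^n) | π(t I_n, μ_st) f = λ f}`. -/
def eigenS (n : ℕ) (lam : ℂ) : Submodule ℂ (RNeg n → ℂ) where
  carrier := {f | f ∈ schwartz n ∧ piOp (tHat n 1) f = lam • f}
  add_mem' {f g} hf hg := by
    refine ⟨(schwartz n).add_mem hf.1 hg.1, ?_⟩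
    rw [smul_add, ← hf.2, ← hg.2]
    funext x
    exact integral_add (integrable_onQuo _ hf.1 _) (integrable_onQuo _ hg.1 _)
  zero_mem' := by
    refine ⟨(schwartz n).zero_mem, ?_⟩
    funext x
    simp [piOp, onQuo]
  smul_mem' c f hf := by
    refine ⟨(schwartz n).smul_mem c hf.1, ?_⟩
    rw [smul_comm, ← hf.2]
    funext x
    exact integral_const_mul c _

end

end LoopRep

open LoopRep

open scoped FourierTransform SchwartzMap RealInnerProductSpace NNReal

namespace LoopRep

section SchwartzIntegral

variable {U W : Type*} [NormedAddCommGroup U] [InnerProductSpace ℝ U] [NormedAddCommGroup W]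
  [InnerProductSpace ℝ W] [FiniteDimensional ℝ W] [MeasurableSpace W] [BorelSpace W]

theorem exists_bound_comp_toLp (s : 𝓢(WithLp 2 (U × W), ℂ)) :
    ∃ b : W → ℝ, Integrable b ∧ ∀ x y, ‖s (WithLp.toLp 2 (x, y))‖ ≤ b y := by
  let k : ℕ := Module.finrank ℝ W + 1
  let C : ℝ := 2 ^ k * (Finset.Iic (k, 0)).sup
    (fun m => SchwartzMap.seminorm ℝ m.1 m.2) s
  refine ⟨fun y => C * (1 + ‖y‖) ^ (-(k : ℝ)),
    (integrable_one_add_norm (by simp [k])).const_mul C, fun x y => ?_⟩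
  have h := SchwartzMap.one_add_le_sup_seminorm_apply (𝕜 := ℝ) (m := (k, 0)) le_rfl le_rfl s
    (WithLp.toLp 2 (x, y))
  rw [norm_iteratedFDeriv_zero] at h
  have hy : ‖y‖ ≤ ‖WithLp.toLp 2 (x, y)‖ := WithLp.norm_snd_le (p := 2) U (WithLp.toLp 2 (x, y))
  have hpos : 0 < (1 + ‖y‖) ^ k := by positivity
  change _ ≤ C * (1 + ‖y‖) ^ (-(k : ℝ))
  rw [Real.rpow_neg (by positivity), Real.rpow_natCast, ← div_eq_mul_inv, le_div_iff₀ hpos,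
    mul_comm]
  refine le_trans ?_ h
  gcongr

theorem continuous_integral_toLp (s : 𝓢(WithLp 2 (U × W), ℂ)) :
    Continuous fun x : U => ∫ y : W, s (WithLp.toLp 2 (x, y)) := by
  obtain ⟨b, hb, hs⟩ := exists_bound_comp_toLp s
  refine continuous_of_dominated (bound := b) (fun x => ?_)
    (fun x => Filter.Eventually.of_forall (hs x)) hb (Filter.Eventually.of_forall fun y => ?_)
  · exact Continuous.aestronglyMeasurable
      (s.continuous.comp ((WithLp.prod_continuous_toLp 2 U W).comp (by fun_prop)))
  · exact s.continuous.comp ((WithLp.prod_continuous_toLp 2 U W).comp (by fun_prop))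

variable [FiniteDimensional ℝ U] [MeasurableSpace U] [BorelSpace U]

theorem integrable_comp_toLp (s : 𝓢(WithLp 2 (U × W), ℂ)) :
    Integrable (fun p : U × W => s (WithLp.toLp 2 p)) (volume.prod volume) :=
  ((WithLp.volume_preserving_toLp U W).integrable_comp_emb
    (MeasurableEquiv.toLp 2 (U × W)).measurableEmbedding).2 s.integrable

theorem fourier_integral_toLp (s : 𝓢(WithLp 2 (U × W), ℂ)) (ξ : U) :
    𝓕 (fun x : U => ∫ y : W, s (WithLp.toLp 2 (x, y))) ξ = 𝓕 s (WithLp.toLp 2 (ξ, 0)) := by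
  rw [SchwartzMap.fourier_coe, Real.fourier_eq, Real.fourier_eq,
    ← (WithLp.volume_preserving_toLp U W).integral_comp
      (MeasurableEquiv.toLp 2 (U × W)).measurableEmbedding]
  refine Eq.trans ?_ (integral_prod (μ := (volume : Measure U)) (ν := (volume : Measure W))
    (fun p : U × W => Real.fourierChar
      (-⟪WithLp.toLp 2 p, WithLp.toLp 2 (ξ, (0 : W))⟫) • s (WithLp.toLp 2 p)) ?_).symm
  · refine integral_congr_ae (Filter.Eventually.of_forall fun x => ?_)
    simp only [WithLp.prod_inner_apply, inner_zero_right, add_zero, Circle.smul_def,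
      integral_smul]
  · refine (integrable_comp_toLp s).mono ?_ (Filter.Eventually.of_forall fun p => ?_)
    · refine Continuous.aestronglyMeasurable ?_
      have h1 : Continuous fun p : U × W => s (WithLp.toLp 2 p) :=
        s.continuous.comp (WithLp.prod_continuous_toLp 2 U W)
      have h2 : Continuous fun p : U × W => Real.fourierChar
          (-⟪WithLp.toLp 2 p, WithLp.toLp 2 (ξ, (0 : W))⟫) := by
        refine Real.continuous_fourierChar.comp (Continuous.neg ?_)
        exact (WithLp.prod_continuous_toLp 2 U W).inner continuous_const
      exact h2.smul h1
    · rw [Circle.norm_smul]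

theorem exists_schwartz_integral_toLp (s : 𝓢(WithLp 2 (U × W), ℂ)) :
    ∃ r : 𝓢(U, ℂ), ∀ x, r x = ∫ y : W, s (WithLp.toLp 2 (x, y)) := by
  let ι : U →L[ℝ] WithLp 2 (U × W) :=
    (WithLp.prodContinuousLinearEquiv 2 ℝ U W).symm.toContinuousLinearMap ∘L
      ContinuousLinearMap.inl ℝ U W
  have hι : AntilipschitzWith 1 ι := by
    refine AddMonoidHomClass.antilipschitz_of_bound ι fun x => ?_
    rw [NNReal.coe_one, one_mul]
    exact WithLp.norm_fst_le (p := 2) U (ι x)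
  let h : 𝓢(U, ℂ) := SchwartzMap.compCLMOfAntilipschitz ℝ ι.hasTemperateGrowth hι (𝓕 s)
  have hP : 𝓕 (fun x : U => ∫ y : W, s (WithLp.toLp 2 (x, y))) = h := by
    funext ξ
    exact fourier_integral_toLp s ξ
  refine ⟨𝓕⁻ h, fun x => ?_⟩
  rw [SchwartzMap.fourierInv_coe, ← hP, (continuous_integral_toLp s).fourierInv_fourier_eq
    (integrable_comp_toLp s).integral_prod_left]
  rw [hP]
  exact h.integrable

end SchwartzIntegral

section

variable {n : ℕ}

theorem onQuo_piOp (α : MHat n) (f : RNeg n → ℂ) (q : Quo n) :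
    onQuo (piOp α f) q =
      ∫ y, onQuo f (cls (act (α.g : GL (Fin n) F)⁻¹ (rep q)) + incl α.g y) ∂α.μ := rfl

theorem onFn_piOp (α : MHat n) (f : RNeg n → ℂ) (x : Fin n → F) :
    onFn (piOp α f) x =
      ∫ y, onQuo f (cls (act (α.g : GL (Fin n) F)⁻¹ x) + incl α.g y) ∂α.μ := by
  obtain ⟨u, hu⟩ := exists_incl_rep α.g x
  refine (onQuo_piOp α f (cls x)).trans ?_
  rw [hu, ← integral_add_left_eq_self
    (fun y => onQuo f (cls (act (α.g : GL (Fin n) F)⁻¹ x) + incl α.g y)) u]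
  refine integral_congr_ae (Filter.Eventually.of_forall fun y => ?_)
  simp only [map_add, add_assoc]

theorem piOp_mul (α β : MHat n) {f : RNeg n → ℂ} (hf : f ∈ schwartz n) :
    piOp (α * β) f = piOp α (piOp β f) := by
  funext x
  let c : Quo n := cls (act ((α.g * β.g : MInt n) : GL (Fin n) F)⁻¹ (toFn x))
  have hint : Integrable (fun v => onQuo f (c + incl (α.g * β.g) v)) (conv α β) :=
    integrable_onQuo (α * β) hf c
  refine (integral_conv α β _ hint).trans ?_
  refine integral_congr_ae (Filter.Eventually.of_forall fun y => ?_)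
  have hy : cls (act (α.g : GL (Fin n) F)⁻¹ (toFn x)) + incl α.g y =
      cls (act (α.g : GL (Fin n) F)⁻¹ (toFn x) + rep (incl α.g y)) := by
    rw [map_add, cls_rep]
  change _ = onQuo (piOp β f) (cls (act (α.g : GL (Fin n) F)⁻¹ (toFn x)) + incl α.g y)
  rw [hy]
  refine Eq.trans ?_ (onFn_piOp β f _).symm
  refine integral_congr_ae (Filter.Eventually.of_forall fun z => ?_)
  simp only [incl_convEquiv, c, Submonoid.coe_mul, mul_inv_rev, act_mul, map_add, add_assoc]

theorem piOp_one (f : RNeg n → ℂ) : piOp 1 f = f := by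
  funext x
  change ∫ y : V (1 : MInt n), onQuo f (cls (act ((1 : MInt n) : GL (Fin n) F)⁻¹ (toFn x)) +
    incl (1 : MInt n) y) ∂Measure.count = f x
  have h0 : (default : V (1 : MInt n)) = 0 := rfl
  rw [integral_unique, h0, map_zero, add_zero, Submonoid.coe_one, inv_one, act_one]
  have hx : cls (toFn x) = (quoEquiv n).symm x := by
    rw [← cls_rep ((quoEquiv n).symm x)]
    simp [rep]
  rw [hx, onQuo, LinearEquiv.apply_symm_apply]
  simp [Measure.real]

theorem piOp_add (α : MHat n) {f h : RNeg n → ℂ} (hf : f ∈ schwartz n) (hh : h ∈ schwartz n) :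
    piOp α (f + h) = piOp α f + piOp α h := by
  funext x
  exact integral_add (integrable_onQuo _ hf _) (integrable_onQuo _ hh _)

theorem piOp_smul (α : MHat n) (c : ℂ) (f : RNeg n → ℂ) : piOp α (c • f) = c • piOp α f := by
  funext x
  exact integral_const_mul c _

/-- The map `(x, y) ↦ g⁻¹x + y` on `R_-^n × V_g` is injective. -/
theorem act_inv_add_incl_injective (g : MInt n) {x : RNeg n} {y : V g}
    (h : cls (act (g : GL (Fin n) F)⁻¹ (toFn x)) + incl g y = 0) : x = 0 ∧ y = 0 := by
  have h2 : cls (act (g : GL (Fin n) F)⁻¹ (toFn x)) ∈ subV g := by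
    rw [eq_neg_of_add_eq_zero_left h]
    exact (subV g).neg_mem (incl_mem g y)
  rw [cls_mem_subV, act_act_inv] at h2
  have hx : x = 0 :=
    Subtype.ext ((Submodule.disjoint_def.1 (isCompl_latR_negR n).disjoint) _ h2 x.2)
  subst hx
  refine ⟨rfl, incl_injective g ?_⟩
  rwa [map_zero, map_zero, map_zero, zero_add, ← map_zero (incl g)] at h

/-- Schwartz functions on `R_-^n` pulled back along injective linear maps. -/
theorem exists_schwartz_comp {f : RNeg n → ℂ} (hf : f ∈ schwartz n) {E : Type*}
    [NormedAddCommGroup E] [NormedSpace ℝ E] [FiniteDimensional ℝ E] (A : E →ₗ[ℝ] RNeg n)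
    (hA : Function.Injective A) : ∃ s : 𝓢(E, ℂ), ∀ v, s v = f (A v) := by
  let e : EuclideanSpace ℝ (Fin (Module.finrank ℝ E)) ≃ₗ[ℝ] E :=
    LinearEquiv.ofFinrankEq _ _ (by simp)
  let e' := LinearEquiv.ofInjective A hA
  obtain ⟨s, hs⟩ := hf (LinearMap.range A) _ (e.trans e')
  refine ⟨SchwartzMap.compCLMOfContinuousLinearEquiv ℝ e.symm.toContinuousLinearEquiv s,
    fun v => ?_⟩
  rw [SchwartzMap.compCLMOfContinuousLinearEquiv_apply]
  refine (hs _).trans ?_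
  simp [e']

theorem piOp_mem_schwartz (α : MHat n) {f : RNeg n → ℂ} (hf : f ∈ schwartz n) :
    piOp α f ∈ schwartz n := by
  intro W m e
  let c : V α.g ≃L[ℝ] EuclideanSpace ℝ (Fin (Module.finrank ℝ (V α.g))) :=
    (coordV α.g).trans (EuclideanSpace.equiv _ ℝ).symm
  let A : EuclideanSpace ℝ (Fin m) × EuclideanSpace ℝ (Fin (Module.finrank ℝ (V α.g))) →ₗ[ℝ]
      RNeg n := (quoEquiv n).toLinearMap ∘ₗ
    ((cls ∘ₗ act (α.g : GL (Fin n) F)⁻¹ ∘ₗ toFn ∘ₗ W.subtype ∘ₗ e.toLinearMap).coprod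
      (incl α.g ∘ₗ c.symm.toLinearEquiv.toLinearMap))
  have hA : Function.Injective A := by
    rw [← LinearMap.ker_eq_bot, LinearMap.ker_eq_bot']
    rintro ⟨x, y⟩ h
    have h' : cls (act (α.g : GL (Fin n) F)⁻¹ (toFn (e x : RNeg n))) + incl α.g (c.symm y) = 0 :=
      (quoEquiv n).map_eq_zero_iff.1 h
    obtain ⟨h1, h2⟩ := act_inv_add_incl_injective α.g h'
    have h3 : x = 0 := e.map_eq_zero_iff.1 (Subtype.ext h1)
    have h4 : y = 0 := c.symm.map_eq_zero_iff.1 h2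
    rw [h3, h4]
    rfl
  obtain ⟨s, hs⟩ := exists_schwartz_comp hf
    (A ∘ₗ (WithLp.linearEquiv 2 ℝ (EuclideanSpace ℝ (Fin m) ×
      EuclideanSpace ℝ (Fin (Module.finrank ℝ (V α.g))))).toLinearMap)
    (hA.comp (WithLp.linearEquiv 2 ℝ _).injective)
  obtain ⟨r, hr⟩ := exists_schwartz_integral_toLp s
  have hμ : (α.μ.map c).IsAddHaarMeasure := c.isAddHaarMeasure_map α.μ
  let k := Measure.addHaarScalarFactor (α.μ.map c) volume
  have hk : α.μ.map c = k • volume := Measure.isAddLeftInvariant_eq_smul _ _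
  refine ⟨(k : ℝ) • r, fun v => ?_⟩
  have hc : MeasurableEmbedding c := c.toHomeomorph.measurableEmbedding
  have h1 : piOp α f (e v : RNeg n) = ∫ w, f (A (v, w)) ∂(α.μ.map c) := by
    rw [hc.integral_map]
    refine integral_congr_ae (Filter.Eventually.of_forall fun y => ?_)
    change onQuo f (_ + incl α.g y) = onQuo f (_ + incl α.g (c.symm (c y)))
    rw [c.symm_apply_apply]
    rfl
  rw [h1, hk, integral_smul_nnreal_measure, smul_apply, hr]
  simp only [hs]
  rfl

theorem coe_tInt (n l : ℕ) : ((tInt n l : MInt n) : GL (Fin n) F) = tGL n l := rfl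

theorem tGL_inv (n : ℕ) (k : ℤ) : (tGL n k)⁻¹ = tGL n (-k) := by
  rw [inv_eq_iff_mul_eq_one, ← tGL_add, add_neg_cancel, tGL_zero]

theorem tInt_add (n l m : ℕ) : tInt n (m + l) = tInt n l * tInt n m := by
  refine Subtype.ext ?_
  rw [Submonoid.coe_mul, coe_tInt, coe_tInt, coe_tInt, ← tGL_add]
  push_cast
  rw [add_comm]

theorem rep_cls_of_mem {x : Fin n → F} (hx : x ∈ negR n) : rep (cls x) = x := by
  have h1 : rep (cls x) - x ∈ latR n := (Submodule.Quotient.eq _).1 (cls_rep (cls x))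
  have h2 : rep (cls x) - x ∈ negR n := (negR n).sub_mem (quoEquiv n (cls x)).2 hx
  exact sub_eq_zero.1 ((Submodule.disjoint_def.1 (isCompl_latR_negR n).disjoint) _ h1 h2)

theorem negVec_mem (n l : ℕ) (c : Fin l × Fin n → ℝ) : negVec n l c ∈ negR n :=
  fun i k hk => negVec_coeff_eq_zero n l c i k (Or.inl hk)

/-- The indices of the basis of `V_{t^{m+l}}`, split into those from `t^{-m}V_{t^l}` and those
from `V_{t^m}`. -/
def splitIndex (n l m : ℕ) : (Fin l × Fin n) ⊕ (Fin m × Fin n) ≃ Fin (m + l) × Fin n :=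
  (Equiv.sumProdDistrib _ _ _).symm.trans
    (Equiv.prodCongr ((Equiv.sumComm _ _).trans finSumFinEquiv) (Equiv.refl _))

/-- Joining coordinates on `V_{t^l}` and on `V_{t^m}` to coordinates on `V_{t^{m+l}}`. -/
def joinCoord (n l m : ℕ) :
    (Fin l × Fin n → ℝ) × (Fin m × Fin n → ℝ) ≃ᵐ (Fin (m + l) × Fin n → ℝ) :=
  (MeasurableEquiv.sumPiEquivProdPi fun _ => ℝ).symm.trans
    (MeasurableEquiv.piCongrLeft (fun _ => ℝ) (splitIndex n l m))

theorem measurePreserving_joinCoord (n l m : ℕ) :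
    MeasurePreserving (joinCoord n l m) (volume.prod volume) volume :=
  (volume_measurePreserving_piCongrLeft (fun _ => ℝ) (splitIndex n l m)).comp
    (volume_measurePreserving_sumPiEquivProdPi_symm fun _ => ℝ)

theorem joinCoord_apply (n l m : ℕ) (p : (Fin l × Fin n → ℝ) × (Fin m × Fin n → ℝ))
    (a : (Fin l × Fin n) ⊕ (Fin m × Fin n)) :
    joinCoord n l m p (splitIndex n l m a) = Sum.elim p.1 p.2 a := by
  refine (Equiv.piCongrLeft_apply_apply (fun _ => ℝ) (splitIndex n l m) _ a).trans ?_
  rcases a with a | a <;> rfl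

theorem joinCoord_fst (n l m : ℕ) (p : (Fin l × Fin n → ℝ) × (Fin m × Fin n → ℝ)) (i : Fin l)
    (j : Fin n) : joinCoord n l m p (Fin.natAdd m i, j) = p.1 (i, j) :=
  joinCoord_apply n l m p (Sum.inl (i, j))

theorem joinCoord_snd (n l m : ℕ) (p : (Fin l × Fin n → ℝ) × (Fin m × Fin n → ℝ)) (i : Fin m)
    (j : Fin n) : joinCoord n l m p (Fin.castAdd l i, j) = p.2 (i, j) :=
  joinCoord_apply n l m p (Sum.inr (i, j))

theorem negVec_joinCoord (n l m : ℕ) (p : (Fin l × Fin n → ℝ) × (Fin m × Fin n → ℝ)) :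
    negVec n (m + l) (joinCoord n l m p) =
      act (tGL n m)⁻¹ (negVec n l p.1) + negVec n m p.2 := by
  funext j
  ext k
  have hact : (act (tGL n m)⁻¹ (negVec n l p.1) j).coeff k =
      (negVec n l p.1 j).coeff (k + m) := by
    rw [tGL_inv, ← act_tGL_coeff (-(m : ℤ)) _ j (k + m), add_neg_cancel_right]
  rw [Pi.add_apply, HahnSeries.coeff_add, hact]
  by_cases hk : 0 ≤ k ∨ k < -((m : ℤ) + l)
  · rw [negVec_coeff_eq_zero _ _ _ _ _ (by push_cast; exact hk),
      negVec_coeff_eq_zero _ _ _ _ _ (by omega), negVec_coeff_eq_zero _ _ _ _ _ (by omega),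
      add_zero]
  · push Not at hk
    by_cases hkm : k < -(m : ℤ)
    · obtain ⟨i, hi⟩ : ∃ i : Fin l, k = -(m : ℤ) + -((i : ℤ) + 1) :=
        ⟨⟨(-k - m - 1).toNat, by omega⟩, by simp; omega⟩
      have h1 := negVec_coeff n (m + l) (joinCoord n l m p) j (Fin.natAdd m i)
      rw [joinCoord_fst, show -(((Fin.natAdd m i : Fin (m + l)) : ℤ) + 1) = k by
        rw [Fin.val_natAdd]; push_cast; omega] at h1
      have h2 := negVec_coeff n l p.1 j i
      rw [show -((i : ℤ) + 1) = k + m by omega] at h2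
      rw [h1, h2, negVec_coeff_eq_zero _ _ p.2 _ _ (Or.inr hkm), add_zero]
    · obtain ⟨i, hi⟩ : ∃ i : Fin m, k = -((i : ℤ) + 1) :=
        ⟨⟨(-k - 1).toNat, by omega⟩, by simp; omega⟩
      have h1 := negVec_coeff n (m + l) (joinCoord n l m p) j (Fin.castAdd l i)
      rw [joinCoord_snd, show -(((Fin.castAdd l i : Fin (m + l)) : ℤ) + 1) = k by
        rw [Fin.val_castAdd]; omega] at h1
      have h2 := negVec_coeff n m p.2 j i
      rw [← hi] at h2
      rw [h1, h2, negVec_coeff_eq_zero _ _ p.1 _ _ (Or.inl (by omega)), zero_add]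

theorem measurable_coordT (n l : ℕ) :
    Measurable (show (Fin l × Fin n → ℝ) → V (tInt n l) from coordT n l) :=
  (toCLE (show (Fin l × Fin n → ℝ) ≃ₗ[ℝ] V (tInt n l) from coordT n l)).continuous.measurable

theorem lintegral_muSt (n l : ℕ) {φ : Quo n → ENNReal}
    (hφ : Measurable fun v : V (tInt n l) => φ (incl _ v)) :
    ∫⁻ v, φ (incl (tInt n l) v) ∂(tHat n l).μ = ∫⁻ c, φ (cls (negVec n l c)) :=
  lintegral_map hφ (measurable_coordT n l)

theorem measurable_comp_negVec (n l : ℕ) {φ : Quo n → ENNReal}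
    (hφ : Measurable fun v : V (tInt n l) => φ (incl _ v)) :
    Measurable fun c => φ (cls (negVec n l c)) :=
  hφ.comp (measurable_coordT n l)

theorem lintegral_muSt_add (n l m : ℕ) {φ : Quo n → ENNReal}
    (hφ : Measurable fun v : V (tInt n (m + l)) => φ (incl _ v)) :
    ∫⁻ v, φ (incl (tInt n (m + l)) v) ∂(tHat n (m + l)).μ =
      ∫⁻ c, ∫⁻ d, φ (cls (act (tGL n m)⁻¹ (negVec n l c)) + cls (negVec n m d)) := by
  have hm : Measurable fun c => φ (cls (negVec n (m + l) c)) := measurable_comp_negVec n _ hφ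
  refine (lintegral_muSt n (m + l) hφ).trans ?_
  refine ((measurePreserving_joinCoord n l m).lintegral_comp hm).symm.trans ?_
  rw [lintegral_prod (fun p => φ (cls (negVec n (m + l) (joinCoord n l m p))))
    (hm.comp (joinCoord n l m).measurable).aemeasurable]
  simp only [negVec_joinCoord, map_add]

theorem lintegral_tHat_mul (n l m : ℕ) {φ : Quo n → ENNReal}
    (hφ : Measurable fun v : V (tInt n l * tInt n m) => φ (incl _ v)) :
    ∫⁻ v, φ (incl (tInt n l * tInt n m) v) ∂(tHat n l * tHat n m).μ =
      ∫⁻ c, ∫⁻ d, φ (cls (act (tGL n m)⁻¹ (negVec n l c)) + cls (negVec n m d)) := by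
  have hψ : Measurable fun p : V (tInt n l) × V (tInt n m) =>
      φ (cls (act (tGL n m)⁻¹ (rep (incl _ p.1))) + incl _ p.2) :=
    hφ.comp (measurable_convEquiv (tInt n l) (tInt n m))
  refine (lintegral_mul (tHat n l) (tHat n m) φ hφ).trans ?_
  refine (lintegral_muSt n l (φ := fun q => ∫⁻ z, φ (cls (act (tGL n m)⁻¹ (rep q)) +
    incl (tInt n m) z) ∂(tHat n m).μ) (hψ.lintegral_prod_right' (ν := (tHat n m).μ))).trans ?_
  refine lintegral_congr fun c => ?_
  obtain ⟨y, hy⟩ : ∃ y : V (tInt n l), incl (tInt n l) y = cls (negVec n l c) :=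
    ⟨(coordT n l c : subV (tInt n l)), rfl⟩
  rw [← hy]
  have hm : Measurable fun z : V (tInt n m) =>
      φ (cls (act (tGL n m)⁻¹ (rep (incl (tInt n l) y))) + incl _ z) :=
    Measurable.of_uncurry_left (f := fun (y : V (tInt n l)) (z : V (tInt n m)) =>
      φ (cls (act (tGL n m)⁻¹ (rep (incl (tInt n l) y))) + incl (tInt n m) z)) hψ
  refine (lintegral_muSt n m (φ := fun q => φ (cls (act (tGL n m)⁻¹ (rep (incl (tInt n l) y))) +
    q)) hm).trans ?_
  rw [hy, rep_cls_of_mem (negVec_mem n l c)]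

theorem tHat_mul (n l m : ℕ) : tHat n l * tHat n m = tHat n (m + l) :=
  MHat.ext_lintegral (tInt_add n l m).symm fun _ hφ => (lintegral_tHat_mul n l m hφ).trans
    (lintegral_muSt_add n l m (measurable_congr (tInt_add n l m).symm hφ)).symm

theorem tHat_zero (n : ℕ) : tHat n 0 = 1 := by
  refine MHat.ext_lintegral (Subtype.ext (tGL_zero n)) fun φ hφ => ?_
  refine (lintegral_muSt n 0 hφ).trans ?_
  change _ = ∫⁻ v : V (1 : MInt n), φ (incl (1 : MInt n) v) ∂Measure.count
  have h0 : (default : V (1 : MInt n)) = 0 := rfl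
  have h1 : ∀ c : Fin 0 × Fin n → ℝ, negVec n 0 c = 0 := fun c => by
    rw [Subsingleton.elim c 0, map_zero]
  rw [lintegral_unique, lintegral_unique, Measure.count_univ, h0, map_zero, h1, map_zero]
  congr 1
  rw [volume_pi, Measure.pi_univ]
  simp

/-- `I_n` with `c` times the counting measure, for a positive real number `c`. -/
noncomputable def scal (n : ℕ) (c : ℝ≥0ˣ) : MHat n :=
  scalHat n ((c : ℝ≥0) : ENNReal) (ENNReal.coe_ne_zero.2 c.ne_zero) ENNReal.coe_ne_top

theorem lintegral_mul_scal (α : MHat n) (c : ℝ≥0ˣ) {φ : Quo n → ENNReal}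
    (hφ : Measurable fun v : V α.g => φ (incl _ v)) :
    ∫⁻ v, φ (incl _ v) ∂(α * scal n c).μ = (c : ℝ≥0) * ∫⁻ v, φ (incl _ v) ∂α.μ :=
  lintegral_mul_scalHat α _ _ _ φ hφ

theorem lintegral_scal_mul (α : MHat n) (c : ℝ≥0ˣ) {φ : Quo n → ENNReal}
    (hφ : Measurable fun v : V α.g => φ (incl _ v)) :
    ∫⁻ v, φ (incl _ v) ∂(scal n c * α).μ = (c : ℝ≥0) * ∫⁻ v, φ (incl _ v) ∂α.μ := by
  rw [lintegral_mul (scal n c) α φ (measurable_congr (one_mul α.g).symm hφ)]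
  change ∫⁻ y : V (1 : MInt n), ∫⁻ z, φ (cls (act (α.g : GL (Fin n) F)⁻¹
    (rep (incl (1 : MInt n) y))) + incl α.g z) ∂α.μ ∂(((c : ℝ≥0) : ENNReal) • Measure.count) = _
  have h0 : (default : V (1 : MInt n)) = 0 := rfl
  rw [lintegral_unique, Measure.smul_apply, Measure.count_univ, h0, map_zero, map_zero, map_zero,
    map_zero]
  simp [mul_comm]

theorem scal_mul_comm (α : MHat n) (c : ℝ≥0ˣ) : scal n c * α = α * scal n c :=
  MHat.ext_lintegral ((one_mul α.g).trans (mul_one α.g).symm) fun _ hφ =>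
    (lintegral_scal_mul α c (measurable_congr (one_mul α.g) hφ)).trans
      (lintegral_mul_scal α c (measurable_congr (one_mul α.g) hφ)).symm

theorem scal_mul (c d : ℝ≥0ˣ) : scal n (c * d) = scal n c * scal n d := by
  refine MHat.ext_lintegral (mul_one (1 : MInt n)).symm fun φ hφ => ?_
  refine Eq.trans ?_ (lintegral_mul_scal (scal n c) d hφ).symm
  have h : ∀ e : ℝ≥0ˣ, ∫⁻ v, φ (incl (scal n e).g v) ∂(scal n e).μ =
      (e : ℝ≥0) * ∫⁻ v : V (1 : MInt n), φ (incl (1 : MInt n) v) ∂Measure.count :=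
    fun e => lintegral_smul_measure _ _
  rw [h, h, ← mul_assoc, Units.val_mul, ENNReal.coe_mul, mul_comm (((c : ℝ≥0) : ENNReal))]

theorem exists_eq_mul_scal {α β : MHat n} (h : α.g = β.g) : ∃ c : ℝ≥0ˣ, α = β * scal n c := by
  obtain ⟨c, h0, ht, hc⟩ := exists_eq_mul_scalHat α β h
  lift c to ℝ≥0 using ht
  exact ⟨Units.mk0 c (ENNReal.coe_ne_zero.1 h0), hc⟩

theorem mul_scal_injective (α : MHat n) : Function.Injective fun c => α * scal n c := by
  intro c d h
  obtain ⟨K⟩ := (inferInstance : Nonempty (TopologicalSpace.PositiveCompacts (V α.g)))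
  let φ : Quo n → ENNReal := Function.extend (incl α.g) (Set.indicator K 1) 0
  have hφ : (fun v => φ (incl α.g v)) = Set.indicator (K : Set (V α.g)) 1 := by
    funext v
    exact (incl_injective _).extend_apply _ _ v
  have hm : Measurable fun v => φ (incl α.g v) := by
    rw [hφ]
    exact measurable_one.indicator K.isCompact.isClosed.measurableSet
  have hc := lintegral_mul_scal α c hm
  have hd := lintegral_mul_scal α d hm
  have h' : ∫⁻ v, φ (incl _ v) ∂(α * scal n c).μ = ∫⁻ v, φ (incl _ v) ∂(α * scal n d).μ :=
    congrArg (fun γ : MHat n => ∫⁻ v, φ (incl γ.g v) ∂γ.μ) h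
  rw [hc, hd, hφ, lintegral_indicator_one K.isCompact.isClosed.measurableSet] at h'
  have h0 : α.μ K ≠ 0 := (Measure.measure_pos_of_nonempty_interior _ K.interior_nonempty).ne'
  have ht : α.μ K ≠ ⊤ := K.isCompact.measure_lt_top.ne
  exact Units.ext (ENNReal.coe_injective ((ENNReal.mul_left_inj h0 ht).1 h'))

theorem exists_mul_tHat_eq (α : MHat n) :
    ∃ c : ℝ≥0ˣ, α * tHat n 1 = tHat n 1 * α * scal n c :=
  exists_eq_mul_scal (Subtype.ext (tGL_comm 1 (α.g : GL (Fin n) F)).symm)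

/-- The number `c` such that `(g, μ) (t I_n, μ_st) = (t I_n, μ_st) (g, μ) c`. -/
noncomputable def tFactor (α : MHat n) : ℝ≥0ˣ := (exists_mul_tHat_eq α).choose

theorem mul_tHat (α : MHat n) : α * tHat n 1 = tHat n 1 * α * scal n (tFactor α) :=
  (exists_mul_tHat_eq α).choose_spec

theorem tFactor_eq {α : MHat n} {c : ℝ≥0ˣ} (h : α * tHat n 1 = tHat n 1 * α * scal n c) :
    tFactor α = c :=
  mul_scal_injective (tHat n 1 * α) ((mul_tHat α).symm.trans h)

theorem scal_one : scal n 1 = 1 := by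
  refine MHat.ext_lintegral rfl fun φ _ => ?_
  refine (lintegral_smul_measure _ _).trans ?_
  rw [Units.val_one, ENNReal.coe_one, one_smul]
  rfl

theorem tFactor_mul (α β : MHat n) : tFactor (α * β) = tFactor α * tFactor β := by
  refine tFactor_eq ?_
  rw [mul_assoc, mul_tHat, mul_assoc (tHat n 1), ← mul_assoc α, mul_tHat α, scal_mul]
  simp only [mul_assoc]
  rw [← mul_assoc (scal n (tFactor α)) β, scal_mul_comm β]
  simp only [mul_assoc]

theorem tFactor_of_comm {α : MHat n} (h : α * tHat n 1 = tHat n 1 * α) : tFactor α = 1 :=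
  tFactor_eq (by rw [scal_one, mul_one, h])

theorem tFactor_one : tFactor (1 : MHat n) = 1 := tFactor_of_comm (by rw [one_mul, mul_one])

theorem tFactor_tHat (l : ℕ) : tFactor (tHat n l) = 1 :=
  tFactor_of_comm (by rw [tHat_mul, tHat_mul, add_comm])

theorem tFactor_congr {α β : MHat n} (h : α.g = β.g) : tFactor α = tFactor β := by
  obtain ⟨c, rfl⟩ := exists_eq_mul_scal h
  rw [tFactor_mul, tFactor_of_comm (scal_mul_comm (tHat n 1) c), mul_one]

/-- `(g, μ)` for some Haar measure `μ`. -/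
noncomputable def haarHat (g : MInt n) : MHat n := ⟨g, Measure.addHaar, inferInstance⟩

/-- The commutation factor of `(g, μ)` as a function of `g`. -/
noncomputable def tChar (n : ℕ) : MInt n →* ℝ≥0ˣ where
  toFun g := tFactor (haarHat g)
  map_one' := (tFactor_congr (α := haarHat 1) (β := 1) rfl).trans tFactor_one
  map_mul' g h := 
    (tFactor_congr (α := haarHat (g * h)) (β := haarHat g * haarHat h) rfl).trans (tFactor_mul _ _)

theorem tFactor_eq_tChar (α : MHat n) : tFactor α = tChar n α.g :=
  tFactor_congr (α := α) (β := haarHat α.g) rfl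

theorem tChar_tInt (l : ℕ) : tChar n (tInt n l) = 1 :=
  (tFactor_congr (α := haarHat (tInt n l)) (β := tHat n l) rfl).trans (tFactor_tHat l)

/-- A homomorphism on `M_n'(R)` that is trivial on powers of `t` extends to `GL_n(F)`. -/
theorem exists_extend_hom {G : Type*} [CommGroup G] (χ : MInt n →* G)
    (hχ : ∀ l, χ (tInt n l) = 1) : ∃ ψ : GL (Fin n) F →* G, ∀ g : MInt n, ψ g = χ g := by
  choose l hl using fun g : GL (Fin n) F => exists_tGL_mul_mem g
  let ψ : GL (Fin n) F → G := fun g => χ ⟨_, hl g⟩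
  have key : ∀ (g : GL (Fin n) F) (m : ℕ) (h : MInt n), (h : GL (Fin n) F) = tGL n m * g →
      χ h = ψ g := by
    intro g m h hh
    have : tInt n m * ⟨_, hl g⟩ = tInt n (l g) * h := by
      refine Subtype.ext ?_
      rw [Submonoid.coe_mul, Submonoid.coe_mul, hh, coe_tInt, coe_tInt, ← mul_assoc, ← mul_assoc,
        tGL_comm]
    have := congrArg χ this
    rw [map_mul, map_mul, hχ, hχ, one_mul, one_mul] at this
    exact this.symm
  refine ⟨⟨⟨ψ, ?_⟩, ?_⟩, fun g => (key g 0 g ?_).symm⟩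
  · rw [← key 1 0 1 (by simp [tGL_zero]), map_one]
  · intro g h
    refine (key (g * h) (l g + l h) (⟨_, hl g⟩ * ⟨_, hl h⟩) ?_).symm.trans (map_mul _ _ _)
    rw [Submonoid.coe_mul]
    push_cast
    rw [tGL_add, mul_assoc, mul_assoc, ← mul_assoc g, ← tGL_comm, mul_assoc]
  · rw [Nat.cast_zero, tGL_zero, one_mul]

end

section MatrixHom

variable {ι K G : Type*} [Fintype ι] [DecidableEq ι] [Field K] [CommGroup G]

/-- Invertible diagonal matrices. -/
def diagGL (ι K : Type*) [Fintype ι] [DecidableEq ι] [Field K] : (ι → Kˣ) →* GL ι K :=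
  (Units.map (Matrix.diagonalRingHom ι K).toMonoidHom).comp
    (MulEquiv.piUnits (M := fun _ : ι => K)).symm.toMonoidHom

theorem coe_diagGL (d : ι → Kˣ) :
    (diagGL ι K d : Matrix ι ι K) = Matrix.diagonal fun i => (d i : K) := rfl

theorem hom_diagGL_mulSingle (χ : GL ι K →* G) (i j : ι) (a : Kˣ) :
    χ (diagGL ι K (Pi.mulSingle i a)) = χ (diagGL ι K (Pi.mulSingle j a)) := by
  let w := Matrix.GeneralLinearGroup.swap K i j
  have hw : ∀ x y, (w : Matrix ι ι K) x y = if Equiv.swap i j x = y then 1 else 0 := by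
    intro x y
    change Matrix.swap K i j x y = _
    simp [Matrix.swap, PEquiv.toMatrix_apply, eq_comm]
  have h : w * diagGL ι K (Pi.mulSingle i a) = diagGL ι K (Pi.mulSingle j a) * w := by
    refine Units.ext ?_
    ext x y
    rw [Units.val_mul, Units.val_mul, coe_diagGL, coe_diagGL, Matrix.mul_diagonal,
      Matrix.diagonal_mul, hw, Pi.mulSingle_apply, Pi.mulSingle_apply]
    by_cases hxy : Equiv.swap i j x = y
    · rw [if_pos hxy, one_mul, mul_one, ← hxy]
      congr 2
      rw [Equiv.swap_apply_eq_iff, Equiv.swap_apply_left]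
    · rw [if_neg hxy, zero_mul, mul_zero]
  have h' := congrArg χ h
  rw [map_mul, map_mul, mul_comm] at h'
  exact mul_right_cancel h'

theorem hom_transvection [CharZero K] (χ : GL ι K →* G) (t : GL ι K) {i j : ι} (hij : i ≠ j)
    (c : K) (ht : (t : Matrix ι ι K) = Matrix.transvection i j c) : χ t = 1 := by
  let d := diagGL ι K (Pi.mulSingle i (Units.mk0 2 two_ne_zero))
  have h : d * t = t * t * d := by
    refine Units.ext ?_
    rw [Units.val_mul, Units.val_mul, Units.val_mul, ht,
      Matrix.transvection_mul_transvection_same i j hij, coe_diagGL]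
    ext x y
    rw [Matrix.mul_diagonal, Matrix.diagonal_mul, Matrix.transvection, Matrix.transvection,
      Matrix.add_apply, Matrix.add_apply, Matrix.one_apply, Matrix.single_apply,
      Matrix.single_apply]
    simp only [Pi.mulSingle_apply]
    by_cases hx : i = x <;> by_cases hy : j = y <;> by_cases hxy : x = y
    all_goals subst_vars
    all_goals simp_all [eq_comm]
    all_goals ring
  have h' := congrArg χ h
  rw [map_mul, map_mul, map_mul, mul_comm] at h'
  simpa using mul_right_cancel h'

/-- A homomorphism from `GL_n(K)` to a torsion-free commutative group is trivial as soon as it is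
trivial on scalar matrices. -/
theorem hom_GL_eq_one [CharZero K] [IsMulTorsionFree G] (χ : GL ι K →* G)
    (hχ : ∀ a : Kˣ, χ (Matrix.GeneralLinearGroup.scalar ι a) = 1) (g : GL ι K) : χ g = 1 := by
  have hsingle : ∀ i (a : Kˣ), χ (diagGL ι K (Pi.mulSingle i a)) = 1 := by
    intro i a
    have h1 : ∏ j, χ (diagGL ι K (Pi.mulSingle j a)) = 1 := by
      refine (map_prod (χ.comp (diagGL ι K)) _ _).symm.trans ?_
      rw [Finset.univ_prod_mulSingle (fun _ => a), ← hχ a]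
      exact congrArg χ (Units.ext rfl)
    rw [Finset.prod_congr rfl fun j _ => hom_diagGL_mulSingle χ j i a, Finset.prod_const] at h1
    have : Nonempty ι := ⟨i⟩
    exact (pow_eq_one_iff_left (Finset.card_ne_zero.2 Finset.univ_nonempty)).1 h1
  have hdiag : ∀ d, χ (diagGL ι K d) = 1 := by
    intro d
    rw [← Finset.univ_prod_mulSingle d]
    refine (map_prod (χ.comp (diagGL ι K)) _ _).trans ?_
    exact Finset.prod_eq_one fun i _ => hsingle i (d i)
  suffices ∀ h : GL ι K, (h : Matrix ι ι K) = g → χ h = 1 from this g rfl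
  have hdet : (g : Matrix ι ι K).det ≠ 0 := (Matrix.GeneralLinearGroup.det g).ne_zero
  refine Matrix.diagonal_transvection_induction_of_det_ne_zero
    (fun M => ∀ h : GL ι K, (h : Matrix ι ι K) = M → χ h = 1) (g : Matrix ι ι K) hdet ?_ ?_ ?_
  · intro D hD h hh
    rw [Matrix.det_diagonal, Finset.prod_ne_zero_iff] at hD
    rw [← hdiag fun i => Units.mk0 (D i) (hD i (Finset.mem_univ i))]
    congr 1
    exact Units.ext hh
  · intro t h hh
    exact hom_transvection χ h t.hij t.c hh
  · intro A B hA hB hPA hPB h hh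
    have : h = Matrix.GeneralLinearGroup.mkOfDetNeZero A hA *
        Matrix.GeneralLinearGroup.mkOfDetNeZero B hB := Units.ext hh
    rw [this, map_mul, hPA _ rfl, hPB _ rfl, one_mul]

end MatrixHom

section

variable {n : ℕ}

/-- The absolute value of the coefficient of the lowest power of `t`. -/
noncomputable def lcAbs : Fˣ →* ℝ≥0ˣ :=
  Units.map
    { toFun := fun a : F => ‖a.leadingCoeff‖₊
      map_one' := by simp
      map_mul' := fun a b => by rw [HahnSeries.leadingCoeff_mul, nnnorm_mul] }

theorem coe_lcAbs (a : Fˣ) : (lcAbs a : ℝ≥0) = ‖(a : F).leadingCoeff‖₊ := rfl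

theorem lcAbs_tPow (k : ℤ) : lcAbs (tPow k) = 1 := by
  refine Units.ext ?_
  rw [coe_lcAbs]
  simp [tPow]

theorem order_tPow (k : ℤ) : ((tPow k : Fˣ) : F).order = k := by
  simp [tPow]

theorem act_scalar (a : Fˣ) (x : Fin n → F) (i : Fin n) :
    act (Matrix.GeneralLinearGroup.scalar (Fin n) a) x i = a * x i := by
  simp [act_apply, Matrix.mulVec, dotProduct, Matrix.diagonal_apply]

theorem order_inv_eq_zero {u : Fˣ} (hu : (u : F).order = 0) : ((u⁻¹ : Fˣ) : F).order = 0 := by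
  have h := HahnSeries.order_mul u.ne_zero (u⁻¹).ne_zero
  rw [Units.mul_inv, HahnSeries.order_one, hu, zero_add] at h
  exact h.symm

theorem mem_R_of_order_eq_zero {u : F} (hu : u.order = 0) : u ∈ R :=
  (mem_R_iff _).2 fun _ hk => HahnSeries.coeff_eq_zero_of_lt_order (hu ▸ hk)

theorem coeff_zero_inv {u : Fˣ} (hu : (u : F).order = 0) :
    ((u⁻¹ : Fˣ) : F).coeff 0 = (u : F).leadingCoeff⁻¹ := by
  have h1 : ((u⁻¹ : Fˣ) : F).leadingCoeff = ((u⁻¹ : Fˣ) : F).coeff 0 := by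
    rw [HahnSeries.leadingCoeff_eq, order_inv_eq_zero hu]
  rw [← h1]
  refine eq_inv_of_mul_eq_one_right ?_
  rw [← HahnSeries.leadingCoeff_mul, Units.mul_inv, HahnSeries.leadingCoeff_one]

theorem scalar_mem_MInt {u : Fˣ} (hu : (u : F).order = 0) :
    Matrix.GeneralLinearGroup.scalar (Fin n) u ∈ MInt n := by
  intro i j
  have : (Matrix.GeneralLinearGroup.scalar (Fin n) u : Matrix (Fin n) (Fin n) F) i j =
      if i = j then (u : F) else 0 := by
    simp [Matrix.diagonal_apply]
  rw [this]
  split_ifs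
  · exact mem_R_of_order_eq_zero hu
  · exact R.zero_mem

/-- The scalar matrix of a unit of `R`. -/
noncomputable def unitInt (n : ℕ) (u : Fˣ) (hu : (u : F).order = 0) : MInt n :=
  ⟨Matrix.GeneralLinearGroup.scalar (Fin n) u, scalar_mem_MInt hu⟩

theorem incl_unitInt {u : Fˣ} (hu : (u : F).order = 0) (v : V (unitInt n u hu)) :
    incl _ v = 0 := by
  have h := (mem_subV _ _).1 (incl_mem _ v)
  rw [← cls_rep (incl _ v)]
  refine (Submodule.Quotient.mk_eq_zero _).2 fun i => ?_
  have hi := h i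
  change act (Matrix.GeneralLinearGroup.scalar (Fin n) u) _ i ∈ R at hi
  rw [act_scalar] at hi
  have := R.mul_mem (mem_R_of_order_eq_zero (order_inv_eq_zero hu)) hi
  rwa [Units.inv_mul_cancel_left] at this

theorem cls_act_unitInt_inv {u : Fˣ} (hu : (u : F).order = 0) (c : Fin 1 × Fin n → ℝ) :
    cls (act ((unitInt n u hu : MInt n) : GL (Fin n) F)⁻¹ (negVec n 1 c)) =
      cls (negVec n 1 ((u : F).leadingCoeff⁻¹ • c)) := by
  refine (Submodule.Quotient.eq _).2 fun i => (mem_R_iff _).2 fun k hk => ?_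
  have hinv : ((unitInt n u hu : MInt n) : GL (Fin n) F)⁻¹ =
      Matrix.GeneralLinearGroup.scalar (Fin n) u⁻¹ := (map_inv _ _).symm
  have hneg : ∀ d : Fin 1 × Fin n → ℝ,
      negVec n 1 d i = HahnSeries.single (-1 : ℤ) (d (0, i)) := by
    intro d
    simp [negVec]
  rw [Pi.sub_apply, HahnSeries.coeff_sub, hinv, act_scalar, hneg, hneg]
  have h1 : (((u⁻¹ : Fˣ) : F) * HahnSeries.single (-1 : ℤ) (c (0, i))).coeff k =
      ((u⁻¹ : Fˣ) : F).coeff (k + 1) * c (0, i) := by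
    conv_lhs => rw [← add_neg_cancel_right k 1]
    exact HahnSeries.coeff_mul_single_add
  rw [h1]
  rcases (show k ≤ -1 by omega).lt_or_eq with h | rfl
  · rw [(mem_R_iff _).1 (mem_R_of_order_eq_zero (order_inv_eq_zero hu)) _ (by omega),
      HahnSeries.coeff_single_of_ne h.ne, zero_mul, sub_zero]
  · rw [HahnSeries.coeff_single_same, neg_add_cancel, coeff_zero_inv hu]
    simp

theorem lintegral_comp_smul_pi {ι : Type*} [Fintype ι] (f : (ι → ℝ) → ENNReal) (r : ℝ)
    (hr : r ≠ 0) (hf : Measurable f) :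
    ∫⁻ c, f (r⁻¹ • c) = ENNReal.ofReal |r| ^ Fintype.card ι * ∫⁻ c, f c := by
  have h := Measure.map_addHaar_smul (volume : Measure (ι → ℝ)) (inv_ne_zero hr)
  have h2 := lintegral_map (μ := volume) hf (measurable_const_smul (r⁻¹) (α := ι → ℝ))
  rw [← h2, h, lintegral_smul_measure, Module.finrank_fintype_fun_eq_card, inv_pow, inv_inv,
    abs_pow, ENNReal.ofReal_pow (abs_nonneg r)]
  rfl

theorem lintegral_tHat_mul_unit (u : Fˣ) (hu : (u : F).order = 0) {φ : Quo n → ENNReal}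
    (hφ : Measurable fun v : V (tInt n 1 * unitInt n u hu) => φ (incl _ v)) :
    ∫⁻ v, φ (incl (tInt n 1 * unitInt n u hu) v) ∂(tHat n 1 * haarHat (unitInt n u hu)).μ =
      (∫⁻ c, φ (cls (negVec n 1 ((u : F).leadingCoeff⁻¹ • c)))) *
        (haarHat (unitInt n u hu)).μ Set.univ := by
  have hψ : Measurable fun p : V (tInt n 1) × V (unitInt n u hu) =>
      φ (cls (act ((unitInt n u hu : MInt n) : GL (Fin n) F)⁻¹ (rep (incl _ p.1))) +
        incl _ p.2) :=
    hφ.comp (measurable_convEquiv (tInt n 1) (unitInt n u hu))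
  have hm : Measurable fun y : V (tInt n 1) =>
      φ (cls (act ((unitInt n u hu : MInt n) : GL (Fin n) F)⁻¹ (rep (incl _ y)))) := by
    have := Measurable.of_uncurry_right (f := fun (y : V (tInt n 1)) (z : V (unitInt n u hu)) =>
      φ (cls (act ((unitInt n u hu : MInt n) : GL (Fin n) F)⁻¹ (rep (incl (tInt n 1) y))) +
        incl (unitInt n u hu) z)) hψ (y := 0)
    simpa only [map_zero, add_zero] using this
  refine (lintegral_mul (tHat n 1) (haarHat (unitInt n u hu)) φ hφ).trans ?_
  have h1 : ∀ y : V (tInt n 1), ∫⁻ z, φ (cls (act ((unitInt n u hu : MInt n) : GL (Fin n) F)⁻¹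
      (rep (incl (tInt n 1) y))) + incl (unitInt n u hu) z)
        ∂(Measure.addHaar : Measure (V (unitInt n u hu))) =
      φ (cls (act ((unitInt n u hu : MInt n) : GL (Fin n) F)⁻¹ (rep (incl (tInt n 1) y)))) *
        (Measure.addHaar : Measure (V (unitInt n u hu))) Set.univ := by
    intro y
    rw [← lintegral_const]
    exact lintegral_congr fun z => by rw [incl_unitInt hu, add_zero]
  refine (lintegral_congr h1).trans ((lintegral_mul_const (μ := muSt n 1) _ hm).trans ?_)
  refine congrArg (· * (haarHat (unitInt n u hu)).μ Set.univ) ?_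
  refine (lintegral_muSt n 1 (φ := fun q =>
    φ (cls (act ((unitInt n u hu : MInt n) : GL (Fin n) F)⁻¹ (rep q)))) hm).trans ?_
  refine lintegral_congr fun c => ?_
  rw [rep_cls_of_mem (negVec_mem n 1 c), cls_act_unitInt_inv]

theorem measurable_of_unitInt_mul (u : Fˣ) (hu : (u : F).order = 0) {φ : Quo n → ENNReal}
    (hφ : Measurable fun v : V (unitInt n u hu * tInt n 1) => φ (incl _ v)) :
    Measurable fun v : V (tInt n 1) => φ (incl _ v) := by
  have hψ : Measurable fun p : V (unitInt n u hu) × V (tInt n 1) =>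
      φ (cls (act (tGL n 1)⁻¹ (rep (incl _ p.1))) + incl _ p.2) :=
    hφ.comp (measurable_convEquiv (unitInt n u hu) (tInt n 1))
  have := Measurable.of_uncurry_left (f := fun (y : V (unitInt n u hu)) (z : V (tInt n 1)) =>
    φ (cls (act (tGL n 1)⁻¹ (rep (incl (unitInt n u hu) y))) + incl (tInt n 1) z)) hψ (x := 0)
  simpa only [map_zero, zero_add] using this

theorem lintegral_unit_mul_tHat (u : Fˣ) (hu : (u : F).order = 0) {φ : Quo n → ENNReal}
    (hφ : Measurable fun v : V (unitInt n u hu * tInt n 1) => φ (incl _ v)) :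
    ∫⁻ v, φ (incl (unitInt n u hu * tInt n 1) v) ∂(haarHat (unitInt n u hu) * tHat n 1).μ =
      (∫⁻ c, φ (cls (negVec n 1 c))) * (haarHat (unitInt n u hu)).μ Set.univ := by
  refine (lintegral_mul (haarHat (unitInt n u hu)) (tHat n 1) φ hφ).trans ?_
  have h1 : ∀ y : V (unitInt n u hu), ∫⁻ z : V (tInt n 1), φ (cls (act (tGL n 1)⁻¹
      (rep (incl (unitInt n u hu) y))) + incl (tInt n 1) z) ∂(muSt n 1) =
      ∫⁻ c, φ (cls (negVec n 1 c)) := by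
    intro y
    simp only [incl_unitInt hu, map_zero, zero_add]
    exact lintegral_muSt n 1 (measurable_of_unitInt_mul u hu hφ)
  exact (lintegral_congr h1).trans (lintegral_const _)

theorem lintegral_negVec_smul (u : Fˣ) {f : (Fin 1 × Fin n → ℝ) → ENNReal} (hf : Measurable f) :
    ∫⁻ c, f ((u : F).leadingCoeff⁻¹ • c) = ((lcAbs u ^ n : ℝ≥0ˣ) : ℝ≥0) * ∫⁻ c, f c := by
  have hr : (u : F).leadingCoeff ≠ 0 := HahnSeries.leadingCoeff_ne_zero.2 u.ne_zero
  rw [lintegral_comp_smul_pi f _ hr hf, Fintype.card_prod, Fintype.card_fin, Fintype.card_fin,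
    one_mul, Units.val_pow_eq_pow_val, ENNReal.coe_pow, coe_lcAbs, ← Real.norm_eq_abs,
    ofReal_norm, enorm_eq_nnnorm]

theorem lintegral_tHat_mul_unit_eq (u : Fˣ) (hu : (u : F).order = 0) {φ : Quo n → ENNReal}
    (hφ : Measurable fun v : V (tInt n 1 * unitInt n u hu) => φ (incl _ v))
    (hφ' : Measurable fun v : V (unitInt n u hu * tInt n 1) => φ (incl _ v)) :
    ∫⁻ v, φ (incl (tInt n 1 * unitInt n u hu) v) ∂(tHat n 1 * haarHat (unitInt n u hu)).μ =
      ((lcAbs u ^ n : ℝ≥0ˣ) : ℝ≥0) *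
        ∫⁻ v, φ (incl (unitInt n u hu * tInt n 1) v) ∂(haarHat (unitInt n u hu) * tHat n 1).μ := by
  have hf : Measurable fun c => φ (cls (negVec n 1 c)) :=
    measurable_comp_negVec n 1 (measurable_of_unitInt_mul u hu hφ')
  refine (lintegral_tHat_mul_unit u hu hφ).trans ?_
  refine Eq.trans ?_ (congrArg _ (lintegral_unit_mul_tHat u hu hφ')).symm
  refine (congrArg (· * _) (lintegral_negVec_smul u hf)).trans ?_
  exact mul_assoc _ _ _

theorem tHat_mul_unit {u : Fˣ} (hu : (u : F).order = 0) :
    tHat n 1 * haarHat (unitInt n u hu) =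
      haarHat (unitInt n u hu) * tHat n 1 * scal n (lcAbs u ^ n) := by
  have hg : tInt n 1 * unitInt n u hu = unitInt n u hu * tInt n 1 := Subtype.ext (tGL_comm 1 _)
  refine MHat.ext_lintegral (hg.trans (mul_one _).symm) fun φ hφ => ?_
  have hφ' := measurable_congr hg hφ
  exact (lintegral_tHat_mul_unit_eq u hu hφ hφ').trans
    (lintegral_mul_scal (haarHat (unitInt n u hu) * tHat n 1) _ hφ').symm

theorem tChar_unitInt {u : Fˣ} (hu : (u : F).order = 0) :
    tChar n (unitInt n u hu) = (lcAbs u ^ n)⁻¹ := by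
  refine tFactor_eq ?_
  rw [tHat_mul_unit, mul_assoc, ← scal_mul, mul_inv_cancel, scal_one, mul_one]

/-- The commutation factor is the inverse of the absolute value of the leading coefficient of the
determinant. -/
theorem tChar_eq (g : MInt n) :
    tChar n g = (lcAbs (Matrix.GeneralLinearGroup.det (g : GL (Fin n) F)))⁻¹ := by
  obtain ⟨ψ, hψ⟩ := exists_extend_hom (tChar n) tChar_tInt
  have hdet : ∀ a : Fˣ, Matrix.GeneralLinearGroup.det
      (Matrix.GeneralLinearGroup.scalar (Fin n) a) = a ^ n := by
    intro a
    refine Units.ext ?_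
    simp
  have hscalar : ∀ a : Fˣ, (ψ * lcAbs.comp (Matrix.GeneralLinearGroup.det (n := Fin n) (R := F)) :
      GL (Fin n) F →* ℝ≥0ˣ)
      (Matrix.GeneralLinearGroup.scalar (Fin n) a) = 1 := by
    intro a
    have hu : ((a * (tPow (a : F).order)⁻¹ : Fˣ) : F).order = 0 := by
      have h := HahnSeries.order_mul (a * (tPow (a : F).order)⁻¹).ne_zero
        (tPow (a : F).order).ne_zero
      rw [← Units.val_mul, inv_mul_cancel_right, order_tPow] at h
      omega
    have ht : ∀ k : ℤ, ψ (tGL n k) = 1 := by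
      have hnat : ∀ l : ℕ, ψ (tGL n l) = 1 := fun l => (hψ (tInt n l)).trans (tChar_tInt l)
      intro k
      obtain ⟨l, rfl | rfl⟩ := k.eq_nat_or_neg
      · exact hnat l
      · rw [← tGL_inv, map_inv, hnat, inv_one]
    have ha : Matrix.GeneralLinearGroup.scalar (Fin n) a =
        (unitInt n _ hu : GL (Fin n) F) * tGL n (a : F).order := by
      change _ = Matrix.GeneralLinearGroup.scalar (Fin n) _ *
        Matrix.GeneralLinearGroup.scalar (Fin n) _
      rw [← map_mul, inv_mul_cancel_right]
    rw [MonoidHom.mul_apply, MonoidHom.comp_apply, hdet, ha, map_mul, hψ, ht, tChar_unitInt,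
      mul_one, map_mul, map_inv, lcAbs_tPow, inv_one, mul_one, map_pow, inv_mul_cancel]
  have : CharZero F := charZero_of_injective_algebraMap (algebraMap ℝ F).injective
  have := hom_GL_eq_one _ hscalar (g : GL (Fin n) F)
  rw [MonoidHom.mul_apply, MonoidHom.comp_apply, hψ] at this
  exact eq_inv_of_mul_eq_one_left this

/-- The elements `(t I_n, μ_st)` are central in the semigroup over `GL_n(F)_0`. -/
theorem mul_tHat_comm (α : MHat0 n) : (α : MHat n) * tHat n 1 = tHat n 1 * (α : MHat n) := by
  have h : tFactor (α : MHat n) = 1 := by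
    rw [tFactor_eq_tChar, tChar_eq, inv_eq_one]
    refine Units.ext ?_
    rw [coe_lcAbs, Units.val_one]
    rcases α.2 with h | h
    · exact (congrArg nnnorm h).trans nnnorm_one
    · exact (congrArg nnnorm h).trans (by rw [nnnorm_neg, nnnorm_one])
  rw [mul_tHat, h, scal_one, mul_one]

theorem piOp_tHat {lam : ℂ} {f : RNeg n → ℂ} (hf : f ∈ eigenS n lam) (l : ℕ) :
    piOp (tHat n l) f = lam ^ l • f := by
  induction l with
  | zero => rw [tHat_zero, piOp_one, pow_zero, one_smul]
  | succ l ih =>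
    rw [← tHat_mul, piOp_mul _ _ hf.1, ih, piOp_smul, hf.2, smul_smul, pow_succ]

theorem piOp_mem_eigenS {lam : ℂ} (α : MHat0 n) {f : RNeg n → ℂ} (hf : f ∈ eigenS n lam) :
    piOp α f ∈ eigenS n lam := by
  refine ⟨piOp_mem_schwartz α hf.1, ?_⟩
  rw [← piOp_mul _ _ hf.1, ← mul_tHat_comm, piOp_mul _ _ hf.1, hf.2, piOp_smul]

/-- The operator `π(g, μ)` on `S(R_-^n)_λ`. -/
noncomputable def eigenOp (lam : ℂ) (α : MHat0 n) : eigenS n lam →ₗ[ℂ] eigenS n lam where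
  toFun f := ⟨piOp α f, piOp_mem_eigenS α f.2⟩
  map_add' f h := Subtype.ext (piOp_add _ f.2.1 h.2.1)
  map_smul' c f := Subtype.ext (piOp_smul (α : MHat n) c (f : RNeg n → ℂ))

/-- The action of the pairs `(t^k, (g, μ))` on `S(R_-^n)_λ`. -/
noncomputable def gtildeRep (n : ℕ) {lam : ℂ} (hlam : lam ≠ 0) :
    GTilde n →* Module.End ℂ (eigenS n lam) where
  toFun p := lam ^ (Multiplicative.toAdd p.1) • eigenOp lam p.2
  map_one' := by
    refine LinearMap.ext fun f => Subtype.ext ?_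
    change lam ^ (0 : ℤ) • piOp 1 (f : RNeg n → ℂ) = f
    rw [zpow_zero, one_smul, piOp_one]
  map_mul' p q := by
    refine LinearMap.ext fun f => Subtype.ext ?_
    change lam ^ (Multiplicative.toAdd p.1 + Multiplicative.toAdd q.1) •
      piOp ((p.2 : MHat n) * (q.2 : MHat n)) (f : RNeg n → ℂ) =
      lam ^ (Multiplicative.toAdd p.1) •
        piOp (p.2 : MHat n) (lam ^ (Multiplicative.toAdd q.1) • piOp (q.2 : MHat n) f)
    rw [piOp_mul _ _ f.2.1, piOp_smul, smul_smul, zpow_add₀ hlam]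

theorem tCon_le_ker (n : ℕ) {lam : ℂ} (hlam : lam ≠ 0) : tCon n ≤ Con.ker (gtildeRep n hlam) := by
  refine Con.conGen_le.2 ?_
  rintro _ _ ⟨k, l, α⟩
  refine LinearMap.ext fun f => Subtype.ext ?_
  change lam ^ (k + (l : ℤ)) • piOp (α : MHat n) (f : RNeg n → ℂ) =
    lam ^ k • piOp (tHat n l * (α : MHat n)) (f : RNeg n → ℂ)
  rw [piOp_mul _ _ f.2.1, piOp_tHat (piOp_mem_eigenS α f.2), smul_smul, zpow_add₀ hlam,
    zpow_natCast]

/-- The representation of `GLHat n` on `S(R_-^n)_λ`. -/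
noncomputable def glRep (n : ℕ) {lam : ℂ} (hlam : lam ≠ 0) :
    Representation ℂ (GLHat n) (eigenS n lam) :=
  (tCon n).lift (gtildeRep n hlam) (tCon_le_ker n hlam)

theorem coe_glRep_mk {lam : ℂ} (hlam : lam ≠ 0) (l : ℤ) (α : MHat0 n) (f : eigenS n lam) :
    (glRep n hlam (GLHat.mk l α) f : RNeg n → ℂ) = lam ^ l • piOp (α : MHat n) f := rfl

end

end LoopRep

theorem theorem2p4 (n : ℕ) (lam : ℂ) (hlam : lam ≠ 0) :
    ∃ ρ : Representation ℂ (GLHat n) (eigenS n lam),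
      (∀ (l : ℤ) (α : MHat0 n) (f : eigenS n lam),
        (ρ (GLHat.mk l α) f : RNeg n → ℂ) = lam ^ l • piOp (α : MHat n) (f : RNeg n → ℂ) ∧
        ∀ x : Fin n → F,
          Integrable (fun y : V (α : MHat n).g =>
            onQuo (f : RNeg n → ℂ)
              (cls (act ((α : MHat n).g : GL (Fin n) F)⁻¹ x) + incl (α : MHat n).g y))
            (α : MHat n).μ ∧
          onFn (ρ (GLHat.mk l α) f : RNeg n → ℂ) x =
            lam ^ l * ∫ y : V (α : MHat n).g,
              onQuo (f : RNeg n → ℂ)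
                (cls (act ((α : MHat n).g : GL (Fin n) F)⁻¹ x) + incl (α : MHat n).g y)
              ∂(α : MHat n).μ) ∧
      ∃ σ : Representation ℂ (SLHat n) (eigenS n lam),
        ∀ (a : SLHat n) (f : eigenS n lam), σ a f = ρ (a : GLHat n) f := by
  refine ⟨glRep n hlam, fun l α f => ⟨coe_glRep_mk hlam l α f, fun x =>
    ⟨integrable_onQuo _ f.2.1 _, ?_⟩⟩, (glRep n hlam).comp (SLHat n).subtype, fun _ _ => rfl⟩
  rw [coe_glRep_mk, ← onFn_piOp]
  rfl
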